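/- Let $k$ be a commutative ring. A correspondence functor is a functor from the category of finite sets and correspondences (morphisms $X\to Y$ are the subsets of $Y\times X$, with the usual composition of relations) to $k$-modules, and its dual is $F^\natural(X)=\operatorname{Hom}_k(F(X),k)$, with $F^\natural(Q)(\alpha)=\alpha\circ F(Q^{op})$. For a nonempty finite lattice $T$, let $F_T$ be the correspondence functor for which $F_T(X)$ is the free $k$-module on the set of maps $X\to T$ and $(Q\varphi)(y)=\bigvee_{(y,x)\in Q}\varphi(x)$ for $Q\subseteq Y\times X$. For every finite set $X$ there is a bilinear form $(-,-)_X:F_T(X)\times F_{T^{op}}(X)\to k$ with $(\varphi,\psi)_X=1$ if $\varphi(x)\le_T\psi(x)$ for all $x\in X$, and $(\varphi,\psi)_X=0$ otherwise; orthogonals $\perp$ of subfunctors are taken with respect to these forms. For a finite set $E$, let $\mathcal P_E$ be the quotient of the $k$-algebra of relations on $E$ by the two-sided ideal generated by the relations that factor through a set of cardinality smaller than $|E|$ and by the differences $Q-\overline Q$, where $Q$ is a reflexive relation and $\overline Q$ its transitive closure. For an order $R$ on $E$, let $f_R=\sum_{S\supseteq R}\mu(R,S)\,S\in\mathcal P_E$,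 where $S$ runs through the orders on $E$ containing $R$ and $\mu$ is the Möbius function of the set of orders on $E$ ordered by inclusion. The fundamental functor is $\mathbb S_{E,R}=L/J$, where $L(X)=k\mathcal C(X,E)\otimes_{k\mathcal C(E,E)}\mathcal P_Ef_R$ with $\mathcal C(X,E)$ the set of subsets of $X\times E$, and $J(X)$ consists of the elements $\sum_i\phi_i\otimes w_i$ with $\sum_i(\psi\phi_i)w_i=0$ for all $\psi\in\mathcal C(E,X)$. An element $w\in\mathcal P_Ef_R$ is viewed as an element of $\mathbb S_{E,R}(E)$, namely the class of $\operatorname{id}_E\otimes w$. For a permutation $\sigma$ of $E$ put $\Delta_\sigma=\{(\sigma(x),x)\mid x\in E\}$. Theorem. Let $T$ be a nonempty finite lattice, let $(E,R)$ be its full subposet of join-irreducible elements, and let $\iota:E\to T$ be the inclusion. For $e\in E$ let $r(e)$ be the join of all elements $s<e$ of $T$; for $A\subseteq E$ let $\eta_A:E\to T$ be the map with $\eta_A(e)=r(e)$ if $e\in A$ and $\eta_A(e)=e$ otherwise; let $\gamma_T=\sum_{A\subseteq E}(-1)^{|A|}\eta_A\in F_{T^{op}}(E)$, and let $\langle\gamma_T\rangle$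 be the subfunctor of $F_{T^{op}}$ generated by $\gamma_T$. There is a unique morphism $\Theta_T:F_T\to\mathbb S_{E,R^{op}}$ with $\Theta_T(\iota)=f_{R^{op}}$, and the following hold. (a) $\langle\gamma_T\rangle^\perp=\ker\Theta_T$. (b) $\Theta_T$ induces an isomorphism $F_T/\langle\gamma_T\rangle^\perp\cong\mathbb S_{E,R^{op}}$. (c) There is an isomorphism $j:\langle\gamma_T\rangle^{\perp\perp}\to\mathbb S_{E,R^{op}}^\natural$ such that $j(w)(\Theta_T(a))=(a,w)_X$ for every finite set $X$, all $a\in F_T(X)$ and all $w\in\langle\gamma_T\rangle^{\perp\perp}(X)$. (d) There is a canonical injective morphism $\alpha_{E,R}:\mathbb S_{E,R}\to\mathbb S_{E,R^{op}}^\natural$: there is an isomorphism $\beta:\mathbb S_{E,R}\to\langle\gamma_T\rangle$ with $\beta(f_R)=\gamma_T$, the composite $\alpha_{E,R}$ of $\beta$, the inclusion $\langle\gamma_T\rangle\subseteq\langle\gamma_T\rangle^{\perp\perp}$ and $j$ is injective (at every finite set), and $\alpha_{E,R}$ is the unique morphism $\mathbb S_{E,R}\to\mathbb S_{E,R^{op}}^\natural$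 for which the linear form $\alpha_{E,R}(f_R)$ takes the value $1$ on $f_{R^{op}}$ and $0$ on $\Delta_\sigma f_{R^{op}}$ for every permutation $\sigma\neq1$ of $E$. -/

import Mathlib

open CategoryTheory

universe u v

noncomputable section

namespace CorrFun

/-! ### Finite sets, correspondences, correspondence functors -/

/-- Finite sets, the objects of the category of correspondences. -/
structure FinCorr : Type (u + 1) where
  carrier : Type u
  [fin : Finite carrier]

instance : CoeSort FinCorr.{u} (Type u) := ⟨FinCorr.carrier⟩

instance (X : FinCorr.{u}) : Finite X := X.fin

/-- A correspondence from `X` to `Y` is a subset of `Y × X`. -/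
@[ext]
structure Corr (X Y : FinCorr.{u}) : Type u where
  rel : SetRel Y X

/-- For `S ⊆ Y × X` and `R ⊆ Z × Y`, the composite `S ≫ R` is the correspondence
`R S = {(z, x) | ∃ y, (z, y) ∈ R ∧ (y, x) ∈ S}`. -/
instance : Category.{u} FinCorr.{u} where
  Hom := Corr
  id X := ⟨{p | p.1 = p.2}⟩
  comp S R := ⟨{p | ∃ y, (p.1, y) ∈ R.rel ∧ (y, p.2) ∈ S.rel}⟩
  id_comp f := by
    apply Corr.ext; ext ⟨a, b⟩; simp
  comp_id f := by
    apply Corr.ext; ext ⟨a, b⟩; simp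
  assoc f g h := by
    apply Corr.ext; ext ⟨a, b⟩
    constructor
    · rintro ⟨y, h1, z, h2, h3⟩
      exact ⟨z, ⟨y, h1, h2⟩, h3⟩
    · rintro ⟨z, ⟨y, h1, h2⟩, h3⟩
      exact ⟨y, h1, z, h2, h3⟩

/-- The morphism of the category given by a subset of `Y × X`. -/
def toHom {X Y : FinCorr.{u}} (R : SetRel Y X) : X ⟶ Y := Corr.mk R

/-- The subset of `Y × X` underlying a morphism `X ⟶ Y`. -/
def relOf {X Y : FinCorr.{u}} (R : X ⟶ Y) : SetRel Y X := Corr.rel R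

/-- The opposite correspondence. -/
def opCorr {X Y : FinCorr.{u}} (R : X ⟶ Y) : Y ⟶ X := toHom (relOf R).inv

/-- The opposite, as a functor. -/
def opFunctor : FinCorr.{u}ᵒᵖ ⥤ FinCorr.{u} where
  obj X := X.unop
  map f := opCorr f.unop
  map_id X := by
    apply Corr.ext; ext ⟨a, b⟩
    exact eq_comm
  map_comp f g := by
    apply Corr.ext; ext ⟨a, b⟩
    constructor
    · rintro ⟨y, h1, h2⟩; exact ⟨y, h2, h1⟩
    · rintro ⟨y, h1, h2⟩; exact ⟨y, h2, h1⟩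

/-- Correspondence functors over `k`: functors from finite sets and correspondences to
`k`-modules (equivalently `k`-linear functors on the `k`-linearization of that category). -/
abbrev CorrFunctor (k : Type v) [CommRing k] :=
  FinCorr.{u} ⥤ ModuleCat.{max u v} k

variable {k : Type v} [CommRing k]

/-! ### Subfunctors and quotients -/

/-- A subfunctor of a correspondence functor. -/
@[ext]
structure Sub (F : CorrFunctor.{u} k) where
  obj : (X : FinCorr.{u}) → Submodule k (F.obj X)
  map_mem : ∀ {X Y : FinCorr.{u}} (Q : X ⟶ Y) (x : F.obj X), x ∈ obj X → F.map Q x ∈ obj Y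

namespace Sub

variable {F : CorrFunctor.{u} k}

/-- A subfunctor, as a correspondence functor. -/
def toFunctor (G : Sub F) : CorrFunctor.{u} k where
  obj X := ModuleCat.of k (G.obj X)
  map {X Y} Q := ModuleCat.ofHom ((F.map Q).hom.restrict (fun x hx => G.map_mem Q x hx))
  map_id X := by
    apply ModuleCat.hom_ext
    refine LinearMap.ext fun x => Subtype.ext ?_
    change F.map (𝟙 X) x.1 = x.1
    simp
  map_comp f g := by
    apply ModuleCat.hom_ext
    refine LinearMap.ext fun x => Subtype.ext ?_
    change F.map (f ≫ g) x.1 = F.map g (F.map f x.1)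
    simp

/-- The inclusion of a subfunctor. -/
def incl (G : Sub F) : G.toFunctor ⟶ F where
  app X := ModuleCat.ofHom (G.obj X).subtype
  naturality X Y f := by ext x; rfl

/-- The inclusion between two nested subfunctors. -/
def inclusion {G H : Sub F} (h : ∀ X, G.obj X ≤ H.obj X) : G.toFunctor ⟶ H.toFunctor where
  app X := ModuleCat.ofHom (Submodule.inclusion (h X))
  naturality X Y f := by ext x; rfl

/-- The quotient functor `F / G`. -/
def quot (G : Sub F) : CorrFunctor.{u} k where
  obj X := ModuleCat.of k (F.obj X ⧸ G.obj X)
  map {X Y} Q := ModuleCat.ofHom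
    ((G.obj X).mapQ (G.obj Y) (F.map Q).hom (fun x hx => G.map_mem Q x hx))
  map_id X := by
    ext x
    simp
  map_comp f g := by
    ext x
    simp

/-- The projection `F → F / G`. -/
def proj (G : Sub F) : F ⟶ G.quot where
  app X := ModuleCat.ofHom (G.obj X).mkQ
  naturality X Y f := by ext x; rfl

/-- The kernel of a morphism of correspondence functors. -/
def ker {F' : CorrFunctor.{u} k} (θ : F ⟶ F') : Sub F where
  obj X := LinearMap.ker (θ.app X).hom
  map_mem Q x hx := by
    have hx' : θ.app _ x = 0 := hx
    have := congrArg (fun f => f.hom x) (θ.naturality Q)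
    simp only [ModuleCat.hom_comp, LinearMap.comp_apply] at this
    change θ.app _ (F.map Q x) = 0
    change θ.app _ (F.map Q x) = F'.map Q (θ.app _ x) at this
    rw [this, hx', map_zero]

/-- The subfunctor generated by an element `γ ∈ F(E)`. -/
def gen {E : FinCorr.{u}} (γ : F.obj E) : Sub F where
  obj X := Submodule.span k (Set.range fun Q : E ⟶ X => F.map Q γ)
  map_mem {X Y} Q x hx := by
    have : Submodule.span k (Set.range fun P : E ⟶ X => F.map P γ) ≤
        (Submodule.span k (Set.range fun P : E ⟶ Y => F.map P γ)).comap (F.map Q).hom := by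
      rw [Submodule.span_le]
      rintro _ ⟨P, rfl⟩
      refine Submodule.subset_span ⟨P ≫ Q, ?_⟩
      simp
    exact this hx

lemma mem_gen {E : FinCorr.{u}} (γ : F.obj E) : γ ∈ (gen γ).obj E :=
  Submodule.subset_span ⟨𝟙 E, by simp⟩

/-- `gen γ` is the smallest subfunctor containing `γ`. -/
lemma gen_le {E : FinCorr.{u}} (γ : F.obj E) (G : Sub F) (h : γ ∈ G.obj E) (X : FinCorr.{u}) :
    (gen γ).obj X ≤ G.obj X := by
  refine Submodule.span_le.2 ?_
  rintro _ ⟨P, rfl⟩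
  exact G.map_mem P γ h

end Sub

/-- The dual functor: `F^♮(X) = Hom_k(F(X), k)`, with `F^♮(R)(α) = α ∘ F(R^op)`. -/
def dual (F : CorrFunctor.{u} k) : CorrFunctor.{u} k where
  obj X := ModuleCat.of k (Module.Dual k (F.obj X))
  map R := ModuleCat.ofHom (F.map (opCorr R)).hom.dualMap
  map_id X := by
    have : opCorr (𝟙 X) = 𝟙 X := opFunctor.map_id (Opposite.op X)
    apply ModuleCat.hom_ext
    refine LinearMap.ext fun α => LinearMap.ext fun x => ?_
    change α (F.map (opCorr (𝟙 X)) x) = α x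
    rw [this]
    simp
  map_comp {X Y Z} f g := by
    have : opCorr (f ≫ g) = opCorr g ≫ opCorr f := opFunctor.map_comp g.op f.op
    apply ModuleCat.hom_ext
    refine LinearMap.ext fun α => LinearMap.ext fun x => ?_
    change α (F.map (opCorr (f ≫ g)) x) = α (F.map (opCorr f) (F.map (opCorr g) x))
    rw [this]
    simp

/-- The value at `x ∈ F(X)` of a linear form `α ∈ F^♮(X)`. -/
def dualApply {F : CorrFunctor.{u} k} {X : FinCorr.{u}} (α : (dual F).obj X) (x : F.obj X) : k :=
  (show Module.Dual k (F.obj X) from α) x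

/-! ### The functors `L_{E,W}` and `J_{E,W}`

A module over the algebra `k𝒞(E,E)` is given by a representation of the monoid `End E = 𝒞(E,E)`
(whose product is the composition `Q * Q' = Q Q'` of relations). -/

section LJ

variable {E : FinCorr.{u}} {W : Type max u v} [AddCommGroup W] [Module k W]
  (ρ : Representation k (End E) W)

/-- The submodule of `k𝒞(X,E) ⊗_k W` spanned by all `φα ⊗ w - φ ⊗ αw`. Since `k𝒞(X,E)` is free
on `𝒞(X,E)`, the tensor product over `k` is the direct sum of copies of `W` indexed by `𝒞(X,E)`,
and `φ ⊗ w` is `Finsupp.single φ w`. -/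
def balanced (X : FinCorr.{u}) : Submodule k ((E ⟶ X) →₀ W) :=
  Submodule.span k {t | ∃ (φ : E ⟶ X) (α : End E) (w : W),
    t = Finsupp.single (α ≫ φ) w - Finsupp.single φ (ρ α w)}

/-- Composition with `Q`, as a linear map `k𝒞(X,E) ⊗_k W → k𝒞(Y,E) ⊗_k W`. -/
def postcomp (k : Type v) [CommRing k] (E : FinCorr.{u}) (W : Type max u v) [AddCommGroup W]
    [Module k W] {X Y : FinCorr.{u}} (Q : X ⟶ Y) : ((E ⟶ X) →₀ W) →ₗ[k] ((E ⟶ Y) →₀ W) :=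
  Finsupp.lmapDomain W k (fun φ : E ⟶ X => φ ≫ Q)

lemma postcomp_single {X Y : FinCorr.{u}} (Q : X ⟶ Y) (φ : E ⟶ X) (w : W) :
    postcomp k E W Q (Finsupp.single φ w) = Finsupp.single (φ ≫ Q) w := by
  simp [postcomp]

lemma balanced_le {X Y : FinCorr.{u}} (Q : X ⟶ Y) :
    balanced ρ X ≤ (balanced ρ Y).comap (postcomp k E W Q) := by
  refine Submodule.span_le.2 ?_
  rintro _ ⟨φ, α, w, rfl⟩
  refine Submodule.subset_span ⟨φ ≫ Q, α, w, ?_⟩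
  rw [map_sub, postcomp_single, postcomp_single, Category.assoc]

/-- `L_{E,W}(X) = k𝒞(X,E) ⊗_{k𝒞(E,E)} W`. -/
def LFun : CorrFunctor.{u} k where
  obj X := ModuleCat.of k (((E ⟶ X) →₀ W) ⧸ balanced ρ X)
  map {X Y} Q := ModuleCat.ofHom
    ((balanced ρ X).mapQ (balanced ρ Y) (postcomp k E W Q) (balanced_le ρ Q))
  map_id X := by
    apply ModuleCat.hom_ext
    refine Submodule.linearMap_qext _ (Finsupp.lhom_ext fun φ w => ?_)
    simp [postcomp_single]
  map_comp f g := by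
    apply ModuleCat.hom_ext
    refine Submodule.linearMap_qext _ (Finsupp.lhom_ext fun φ w => ?_)
    simp [postcomp_single]

/-- The element `φ ⊗ w` of `L_{E,W}(X)`. -/
def LFun.tmul {X : FinCorr.{u}} (φ : E ⟶ X) (w : W) : (LFun ρ).obj X :=
  (balanced ρ X).mkQ (Finsupp.single φ w)

/-- The linear map `k𝒞(X,E) ⊗_k W → W`, `φ ⊗ w ↦ (ψφ) w`, for `ψ ∈ 𝒞(E,X)`. -/
def preEval {X : FinCorr.{u}} (ψ : X ⟶ E) : ((E ⟶ X) →₀ W) →ₗ[k] W :=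
  Finsupp.lsum k (fun φ : E ⟶ X => (ρ (φ ≫ ψ : E ⟶ E) : W →ₗ[k] W))

lemma preEval_single {X : FinCorr.{u}} (ψ : X ⟶ E) (φ : E ⟶ X) (w : W) :
    preEval ρ ψ (Finsupp.single φ w) = ρ (φ ≫ ψ : E ⟶ E) w :=
  Finsupp.lsum_single k _ φ w

lemma balanced_le_ker {X : FinCorr.{u}} (ψ : X ⟶ E) :
    balanced ρ X ≤ LinearMap.ker (preEval ρ ψ) := by
  refine Submodule.span_le.2 ?_
  rintro _ ⟨φ, α, w, rfl⟩
  have h : ρ ((α ≫ φ) ≫ ψ : E ⟶ E) = ρ (φ ≫ ψ : E ⟶ E) * ρ α := by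
    rw [← map_mul]
    exact congrArg ρ (Category.assoc α φ ψ)
  simp only [SetLike.mem_coe, LinearMap.mem_ker, map_sub, preEval_single]
  rw [h, Module.End.mul_apply, sub_self]

/-- For `ψ ∈ 𝒞(E,X)`, the linear map `L_{E,W}(X) → W`, `φ ⊗ w ↦ (ψφ) w`. -/
def LFun.eval {X : FinCorr.{u}} (ψ : X ⟶ E) : (LFun ρ).obj X →ₗ[k] W :=
  (balanced ρ X).liftQ (preEval ρ ψ) (balanced_le_ker ρ ψ)

lemma LFun.eval_tmul {X : FinCorr.{u}} (ψ : X ⟶ E) (φ : E ⟶ X) (w : W) :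
    LFun.eval ρ ψ (LFun.tmul ρ φ w) = ρ (φ ≫ ψ : E ⟶ E) w :=
  preEval_single ρ ψ φ w

lemma LFun.eval_map {X Y : FinCorr.{u}} (Q : X ⟶ Y) (ψ : Y ⟶ E) (x : (LFun ρ).obj X) :
    LFun.eval ρ ψ ((LFun ρ).map Q x) = LFun.eval ρ (Q ≫ ψ) x := by
  have h : (preEval ρ ψ).comp (postcomp k E W Q) = preEval ρ (Q ≫ ψ) := by
    refine Finsupp.lhom_ext fun φ w => ?_
    rw [LinearMap.comp_apply, postcomp_single, preEval_single, preEval_single, Category.assoc]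
  obtain ⟨y, rfl⟩ := (balanced ρ X).mkQ_surjective x
  exact LinearMap.congr_fun h y

/-- `J_{E,W}(X)`: the elements `∑ φ_i ⊗ w_i` of `L_{E,W}(X)` with `∑ (ψφ_i) w_i = 0` for all
`ψ ∈ 𝒞(E,X)` (by linearity, for all `ψ ∈ k𝒞(E,X)`). -/
def JSub : Sub (LFun ρ) where
  obj X := ⨅ ψ : X ⟶ E, LinearMap.ker (LFun.eval ρ ψ)
  map_mem {X Y} Q x hx := by
    rw [Submodule.mem_iInf] at hx ⊢
    intro ψ
    exact (LFun.eval_map ρ Q ψ x).trans (hx (Q ≫ ψ))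

end LJ

/-! ### The algebra of permuted orders, fundamental modules and fundamental functors -/

/-- Order relations on `E`: here `(a, b) ∈ R` means `a ≤_R b`. They are ordered by inclusion. -/
def OrderOn (E : Type u) : Type u :=
  {R : SetRel E E // (∀ a, (a, a) ∈ R) ∧ (∀ a b, (a, b) ∈ R → (b, a) ∈ R → a = b) ∧
    ∀ a b c, (a, b) ∈ R → (b, c) ∈ R → (a, c) ∈ R}

instance (E : Type u) : PartialOrder (OrderOn E) :=
  inferInstanceAs (PartialOrder (Subtype _))

instance (E : Type u) [Finite E] : Finite (OrderOn E) :=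
  inferInstanceAs (Finite (Subtype _))

/-- The opposite order. -/
def OrderOn.op {E : Type u} (R : OrderOn E) : OrderOn E :=
  ⟨R.1.inv, fun a => R.2.1 a, fun a b h1 h2 => R.2.2.1 a b h2 h1,
    fun a b c h1 h2 => R.2.2.2 c b a h2 h1⟩

section Fundamental

/-- A relation on `E` is inessential if it factors through a set of smaller cardinality. -/
def Inessential {E : FinCorr.{u}} (Q : End E) : Prop :=
  ∃ (Y : FinCorr.{u}) (A : E ⟶ Y) (B : Y ⟶ E), Nat.card Y < Nat.card E ∧ Q = A ≫ B

/-- Transitive closure of a relation on `E`. -/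
def transClosure {E : FinCorr.{u}} (Q : End E) : End E :=
  toHom {p | Relation.TransGen (fun a b => (a, b) ∈ relOf Q) p.1 p.2}

/-- The relations on the algebra `k𝒞(E,E)` which define the algebra of permuted orders:
inessential relations become zero, and a reflexive relation becomes equal to its transitive
closure. -/
inductive PermOrderRel (k : Type v) [CommRing k] (E : FinCorr.{u}) :
    MonoidAlgebra k (End E) → MonoidAlgebra k (End E) → Prop
  | inessential (Q : End E) : Inessential Q → PermOrderRel k E (MonoidAlgebra.of k (End E) Q) 0
  | closure (Q : End E) : (∀ a : E, (a, a) ∈ relOf Q) →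
      PermOrderRel k E (MonoidAlgebra.of k (End E) Q) (MonoidAlgebra.of k (End E) (transClosure Q))

/-- The algebra of permuted orders `𝒫_E`, a quotient of the algebra of relations `k𝒞(E,E)`
and of the essential algebra. It has as `k`-basis the (classes of the) products `Δ_σ S`, for `σ` a
permutation of `E` and `S` an order on `E`; the product of two orders is the transitive closure of
their union if this is an order, and zero otherwise. -/
def PermOrderAlg (k : Type v) [CommRing k] (E : FinCorr.{u}) : Type max u v :=
  RingQuot (PermOrderRel k E)

instance (k : Type v) [CommRing k] (E : FinCorr.{u}) : Ring (PermOrderAlg k E) :=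
  inferInstanceAs (Ring (RingQuot (PermOrderRel k E)))

instance (k : Type v) [CommRing k] (E : FinCorr.{u}) : Algebra k (PermOrderAlg k E) :=
  inferInstanceAs (Algebra k (RingQuot (PermOrderRel k E)))

/-- The quotient map `k𝒞(E,E) → 𝒫_E`. -/
def PermOrderAlg.quotMap (k : Type v) [CommRing k] (E : FinCorr.{u}) :
    MonoidAlgebra k (End E) →ₐ[k] PermOrderAlg k E :=
  RingQuot.mkAlgHom k (PermOrderRel k E)

/-- The class in `𝒫_E` of a relation on `E`. -/
def permOrderMk (k : Type v) [CommRing k] (E : FinCorr.{u}) : End E →* PermOrderAlg k E :=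
  (PermOrderAlg.quotMap k E : MonoidAlgebra k (End E) →* PermOrderAlg k E).comp
    (MonoidAlgebra.of k (End E))

/-- The relation `Δ_σ = {(σ(x), x) | x ∈ E}`. -/
def permRel {E : FinCorr.{u}} (σ : Equiv.Perm E) : End E :=
  toHom {p | p.1 = σ p.2}

open Classical in
/-- The idempotent `f_R = ∑_{S ⊇ R} μ(R, S) S` of `𝒫_E`, where `S` runs through the orders on `E`
which contain `R` and `μ` is the Möbius function of the poset of orders on `E`. -/
def fIdem (k : Type v) [CommRing k] {E : FinCorr.{u}} (R : OrderOn E) : PermOrderAlg k E :=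
  letI := Fintype.ofFinite (OrderOn E)
  letI : LocallyFiniteOrder (OrderOn E) := Fintype.toLocallyFiniteOrder
  ∑ S : OrderOn E with R ≤ S, IncidenceAlgebra.mu k R S • permOrderMk k E (toHom S.1)

variable (k : Type v) [CommRing k] {E : FinCorr.{u}} (R : OrderOn E)

/-- The fundamental module `𝒫_E f_R`, the left ideal of `𝒫_E` generated by `f_R`. -/
abbrev FundMod : Type max u v := Ideal.span ({fIdem k R} : Set (PermOrderAlg k E))

/-- The action of `k𝒞(E,E)` on the fundamental module, via left multiplication in `𝒫_E`. -/
def fundRep : Representation k (End E) (FundMod k R) :=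
  ((Algebra.lsmul k k (FundMod k R) : PermOrderAlg k E →ₐ[k] Module.End k (FundMod k R)) :
    PermOrderAlg k E →* Module.End k (FundMod k R)).comp (permOrderMk k E)

/-- The fundamental functor `𝕊_{E,R} = L_{E,𝒫_E f_R} / J_{E,𝒫_E f_R}`. -/
def fundFunctor : CorrFunctor.{u} k := (JSub (fundRep k R)).quot

/-- The isomorphism `𝒫_E f_R → 𝕊_{E,R}(E)`, sending `w` to the class of `Δ_E ⊗ w`. -/
def fundEval (w : FundMod k R) : (fundFunctor k R).obj E :=
  (JSub (fundRep k R)).proj.app E (LFun.tmul (fundRep k R) (𝟙 E) w)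

/-- The generator `f_R` of the fundamental module. -/
def fGen : FundMod k R := ⟨fIdem k R, Ideal.subset_span rfl⟩

open Classical in
/-- The property of a morphism `α : 𝕊_{E,R} → 𝕊_{E,R^op}^♮` that the linear form
`α(f_R)` on `𝕊_{E,R^op}(E) ≅ 𝒫_E f_{R^op}` takes the value `1` on `f_{R^op}` and `0` on
`Δ_σ f_{R^op}` for every permutation `σ ≠ 1` of `E`. -/
def IsCanonical (α : fundFunctor k R ⟶ dual (fundFunctor k R.op)) : Prop :=
  ∀ σ : Equiv.Perm E,
    dualApply (α.app E (fundEval k R (fGen k R)))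
      (fundEval k R.op (fundRep k R.op (permRel σ) (fGen k R.op))) = if σ = 1 then 1 else 0

end Fundamental

/-! ### The functor of a finite lattice -/

section Lattice

variable (T : Type u) [Lattice T] [BoundedOrder T]

/-- The action of a correspondence `R ⊆ Y × X` on a map `φ : X → T`:
`(Rφ)(y)` is the join of all `φ(x)` with `(y, x) ∈ R`. -/
def act {T : Type u} [Lattice T] [BoundedOrder T] {X Y : FinCorr.{u}} (R : X ⟶ Y) (φ : X → T) :
    Y → T :=
  fun y => (Set.toFinite {x | (y, x) ∈ relOf R}).toFinset.sup φ

lemma act_le {T : Type u} [Lattice T] [BoundedOrder T] {X Y : FinCorr.{u}} (R : X ⟶ Y)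
    (φ : X → T) (y : Y) (t : T) : act R φ y ≤ t ↔ ∀ x, (y, x) ∈ relOf R → φ x ≤ t := by
  simp [act]

lemma act_id {T : Type u} [Lattice T] [BoundedOrder T] {X : FinCorr.{u}} (φ : X → T) :
    act (𝟙 X) φ = φ := by
  funext y
  apply eq_of_forall_ge_iff
  intro t
  rw [act_le]
  constructor
  · intro h; exact h y rfl
  · intro h x hx
    obtain rfl : y = x := hx
    exact h

lemma act_comp {T : Type u} [Lattice T] [BoundedOrder T] {X Y Z : FinCorr.{u}} (R : X ⟶ Y)
    (S : Y ⟶ Z) (φ : X → T) : act (R ≫ S) φ = act S (act R φ) := by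
  funext z
  apply eq_of_forall_ge_iff
  intro t
  rw [act_le, act_le]
  constructor
  · intro h y hy
    rw [act_le]
    intro x hx
    exact h x ⟨y, hy, hx⟩
  · rintro h x ⟨y, hy, hx⟩
    exact (act_le _ _ _ _).1 (h y hy) x hx

/-- The functor `F_T`: `F_T(X)` is the free `k`-module on the set of maps `X → T`. -/
def FT (k : Type v) [CommRing k] (T : Type u) [Lattice T] [BoundedOrder T] : CorrFunctor.{u} k where
  obj X := ModuleCat.of k ((X → T) →₀ k)
  map R := ModuleCat.ofHom (Finsupp.lmapDomain k k (act R))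
  map_id X := by
    ext φ
    simp [act_id]
  map_comp f g := by
    ext φ
    simp [act_comp]

/-- The basis element of `F_T(X)` given by a map `φ : X → T`. -/
def FT.of (k : Type v) [CommRing k] {T : Type u} [Lattice T] [BoundedOrder T] {X : FinCorr.{u}}
    (φ : X → T) : (FT k T).obj X :=
  (Finsupp.single φ 1 : (X → T) →₀ k)

open Classical in
/-- The bilinear form `k(T^X) × k((T^op)^X) → k`, which sends `(φ, ψ)` to `1` if `φ ≤ ψ`
pointwise in `T`, and to `0` otherwise. -/
def prePairing (k : Type v) [CommRing k] (T : Type u) [Lattice T] (X : FinCorr.{u}) :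
    ((X → T) →₀ k) →ₗ[k] ((X → Tᵒᵈ) →₀ k) →ₗ[k] k :=
  Finsupp.linearCombination k (fun φ : X → T =>
    Finsupp.linearCombination k (fun ψ : X → Tᵒᵈ =>
      if ∀ x, φ x ≤ OrderDual.ofDual (ψ x) then (1 : k) else 0))

/-- The bilinear form `(-,-)_X : F_T(X) × F_{T^op}(X) → k`. -/
def pairing (k : Type v) [CommRing k] (T : Type u) [Lattice T] [BoundedOrder T] (X : FinCorr.{u}) :
    (FT k T).obj X →ₗ[k] (FT k Tᵒᵈ).obj X →ₗ[k] k :=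
  prePairing k T X

lemma pairing_map (k : Type v) [CommRing k] {X Y : FinCorr.{u}} (Q : X ⟶ Y)
    (u : (FT k T).obj Y) (w : (FT k Tᵒᵈ).obj X) :
    pairing k T Y u ((FT k Tᵒᵈ).map Q w) = pairing k T X ((FT k T).map (opCorr Q) u) w := by
  have key : ∀ (φ : Y → T) (ψ : X → Tᵒᵈ), (∀ y, φ y ≤ OrderDual.ofDual (act Q ψ y)) ↔
      ∀ x, act (opCorr Q) φ x ≤ OrderDual.ofDual (ψ x) := by
    intro φ ψ
    simp only [act_le]
    constructor
    · intro h x y hy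
      exact OrderDual.ofDual_le_ofDual.1
        (((act_le Q ψ y (OrderDual.toDual (φ y))).1 (h y)) x hy)
    · intro h y
      exact (act_le Q ψ y (OrderDual.toDual (φ y))).2 fun x hx => h x y hx
  have : (prePairing k T Y).compl₂ (Finsupp.lmapDomain k k (act Q)) =
      (prePairing k T X).comp (Finsupp.lmapDomain k k (act (opCorr Q))) := by
    refine Finsupp.lhom_ext fun φ c => ?_
    refine Finsupp.lhom_ext fun ψ d => ?_
    simp only [LinearMap.compl₂_apply, LinearMap.comp_apply, Finsupp.lmapDomain_apply,
      Finsupp.mapDomain_single, prePairing, Finsupp.linearCombination_single,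
      LinearMap.smul_apply]
    classical
    congr 2
    exact if_congr (key φ ψ) rfl rfl
  exact LinearMap.congr_fun (LinearMap.congr_fun this u) w

variable {T}

/-- The orthogonal in `F_T` of a subfunctor of `F_{T^op}`. -/
def perpLeft (G : Sub (FT k Tᵒᵈ)) : Sub (FT k T) where
  obj X :=
    { carrier := {u | ∀ w ∈ G.obj X, pairing k T X u w = 0}
      add_mem' := fun ha hb w hw => by
        rw [map_add, LinearMap.add_apply, ha w hw, hb w hw, add_zero]
      zero_mem' := fun w _ => by rw [map_zero, LinearMap.zero_apply]
      smul_mem' := fun c a ha w hw => by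
        rw [map_smul, LinearMap.smul_apply, ha w hw, smul_zero] }
  map_mem {X Y} Q a ha w hw := by
    have h := pairing_map T k (opCorr Q) a w
    have e : opCorr (opCorr Q) = Q := rfl
    rw [e] at h
    rw [← h]
    exact ha _ (G.map_mem (opCorr Q) w hw)

/-- The orthogonal in `F_{T^op}` of a subfunctor of `F_T`. -/
def perpRight (H : Sub (FT k T)) : Sub (FT k Tᵒᵈ) where
  obj X :=
    { carrier := {w | ∀ u ∈ H.obj X, pairing k T X u w = 0}
      add_mem' := fun ha hb w hw => by rw [map_add, ha w hw, hb w hw, add_zero]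
      zero_mem' := fun w _ => by rw [map_zero]
      smul_mem' := fun c a ha w hw => by rw [map_smul, ha w hw, smul_zero] }
  map_mem {X Y} Q a ha w hw := by
    rw [pairing_map]
    exact ha _ (H.map_mem (opCorr Q) w hw)

lemma le_perp_perp (G : Sub (FT k Tᵒᵈ)) (X : FinCorr.{u}) :
    G.obj X ≤ (perpRight (perpLeft G)).obj X :=
  fun _ hw _ hu => hu _ hw

variable (T) [Finite T]

/-- The set `E` of (join-)irreducible elements of `T`. -/
def irr : FinCorr.{u} := ⟨{e : T // SupIrred e}⟩

/-- The order `R` on the irreducible elements of `T`, as a full subposet of `T`. -/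
def irrOrder : OrderOn (irr T) :=
  ⟨{p | p.1.1 ≤ p.2.1}, fun _ => le_rfl, fun _ _ h1 h2 => Subtype.ext (le_antisymm h1 h2),
    fun _ _ _ h1 h2 => le_trans h1 h2⟩

/-- The inclusion map `ι : E → T`. -/
def irrIncl : irr T → T := fun e => e.1

variable {T} in
/-- `r(t)` is the join of all elements strictly smaller than `t`. -/
def rJoin (t : T) : T := (Set.toFinite {s : T | s < t}).toFinset.sup id

open Classical in
/-- `η_A : E → T` is given by `η_A(e) = r(e)` if `e ∈ A` and `η_A(e) = e` otherwise. -/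
def eta (A : Finset (irr T)) : irr T → T := fun e => if e ∈ A then rJoin e.1 else e.1

/-- `γ_T = ∑_{A ⊆ E} (-1)^{|A|} η_A^∘ ∈ F_{T^op}(E)`. -/
def gammaT (k : Type v) [CommRing k] : (FT k Tᵒᵈ).obj (irr T) :=
  letI := Fintype.ofFinite (Finset (irr T))
  ∑ A : Finset (irr T), (-1 : k) ^ A.card • FT.of k (fun e => OrderDual.toDual (eta T A e))

/-- The subfunctor `⟨γ_T⟩` of `F_{T^op}` generated by `γ_T`. -/
def gammaSub (k : Type v) [CommRing k] : Sub (FT k Tᵒᵈ) := Sub.gen (gammaT T k)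

/-- The element `γ_T` of `⟨γ_T⟩(E)`. -/
def gammaGen (k : Type v) [CommRing k] : (gammaSub T k).obj (irr T) :=
  ⟨gammaT T k, Sub.mem_gen (gammaT T k)⟩

end Lattice

end CorrFun

end

open CorrFun

/-! Write `ι : E → T` for the inclusion of the irreducible elements. Every map `X → T` is of the
form `Qι`, so that `ι` generates `F_T`, while `f_R` generates `𝕊_{E,R}`. For two functors generated
by `g` and `g'`, both over `E`, a morphism with `g ↦ g'` exists as soon as each linear relation
`∑ u_φ φ g = 0` implies `∑ u_φ φ g' = 0`, and all relations in question are read off from one `0/1`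
matrix.

On the lattice side, `(φ, γ_T)` is `1` if `φ = ι` and `0` otherwise, by expanding
`∏_e ([φ(e) ≤ e] - [φ(e) < e])`; moreover `Qι = ι` if and only if `Δ ⊆ Q ⊆ R^op`. Hence
`(Pι, Qγ_T) = (Q^op P ι, γ_T)` is `1` if `Δ ⊆ Q^op P ⊆ R^op` and `0` otherwise.

On the side of `𝒫_E`, Möbius inversion and Hall's marriage theorem give `Q f_R = Δ_σ f_R` if
`Δ ⊆ Δ_σ⁻¹ Q ⊆ R`, and `Q f_R = 0` if there is no such `σ`. The incidence of this condition
defines a matrix representation of `𝒫_E`, which shows that the `Δ_σ f_R` are linearly independent.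
Hence `∑ u_φ φ f_R` vanishes in `𝕊_{E,R}(X)` if and only if, for each `ψ`, the sum of the `u_φ`
with `Δ ⊆ ψφ ⊆ R` vanishes.

Comparing the two gives `Θ_T` with kernel `⟨γ_T⟩^⊥`, as well as `β`. Since the forms `(-,-)_X` are
perfect, again by Möbius inversion, the orthogonal of `ker Θ_T` is the dual of `𝕊_{E,R^op}`.
-/

noncomputable section

namespace CorrFun

/-! ### Möbius inversion -/

section Moebius

variable {α : Type*} [PartialOrder α] [Fintype α] [DecidableLE α]

lemma eq_of_sum_upper_eq {M : Type*} [AddCommGroup M] {f g : α → M}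
    (h : ∀ a, ∑ b with a ≤ b, f b = ∑ b with a ≤ b, g b) : f = g := by
  classical
  funext a
  induction a using WellFoundedGT.induction with
  | ind a ih =>
    have upper_eq_insert : ({b | a ≤ b} : Finset α) = insert a ({b | a < b} : Finset α) := by
      ext b
      simp [le_iff_eq_or_lt, eq_comm]
    have sum_strict : ∑ b with a < b, f b = ∑ b with a < b, g b :=
      Finset.sum_congr rfl fun b hb => ih b (Finset.mem_filter.1 hb).2
    have := h a
    rwa [upper_eq_insert, Finset.sum_insert (by simp), Finset.sum_insert (by simp), sum_strict,
      add_left_inj] at this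

lemma sum_upper_sum_mu_smul {k M : Type*} [Ring k] [AddCommGroup M] [Module k M]
    [DecidableEq α] [LocallyFiniteOrder α] (g : α → M) (a : α) :
    ∑ b with a ≤ b, ∑ c with b ≤ c, IncidenceAlgebra.mu k b c • g c = g a := by
  calc ∑ b with a ≤ b, ∑ c with b ≤ c, IncidenceAlgebra.mu k b c • g c
      = ∑ c, ∑ b ∈ Finset.Icc a c, IncidenceAlgebra.mu k b c • g c :=
        Finset.sum_comm' (by simp)
    _ = ∑ c, (if a = c then 1 else 0 : k) • g c := by
        simp only [← Finset.sum_smul, IncidenceAlgebra.sum_Icc_mu_left]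
    _ = g a := by simp

end Moebius

/-! ### Relations between an order and the identity -/

section Relations

variable {E : FinCorr.{u}}

/-- `IsReflSubrel R Q` says that `Δ ⊆ Q ⊆ R`, where `Δ` is the equality relation on `E`. Both the
bilinear form on the lattice side and the structure of `𝒫_E f_R` are governed by this condition. -/
def IsReflSubrel (R : OrderOn E) (Q : End E) : Prop :=
  (∀ a : E, (a, a) ∈ relOf Q) ∧ relOf Q ⊆ R.1

lemma corr_ext {X Y : FinCorr.{u}} {P Q : X ⟶ Y}
    (h : ∀ y x, (y, x) ∈ relOf P ↔ (y, x) ∈ relOf Q) : P = Q :=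
  Corr.ext (Set.ext fun p => h p.1 p.2)

lemma mem_relOf_permRel_mul (σ : Equiv.Perm E) (Q : End E) (a b : E) :
    (a, b) ∈ relOf (permRel σ * Q) ↔ (σ⁻¹ a, b) ∈ relOf Q := by
  constructor
  · rintro ⟨c, rfl : a = σ c, h⟩
    rwa [← Equiv.Perm.mul_apply, inv_mul_cancel]
  · exact fun h => ⟨σ⁻¹ a, (σ.apply_symm_apply a).symm, h⟩

lemma mem_relOf_mul_permRel (Q : End E) (σ : Equiv.Perm E) (a b : E) :
    (a, b) ∈ relOf (Q * permRel σ) ↔ (a, σ b) ∈ relOf Q := by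
  constructor
  · rintro ⟨c, h, rfl : c = σ b⟩
    exact h
  · exact fun h => ⟨σ b, h, rfl⟩

lemma permRel_one : permRel (1 : Equiv.Perm E) = 1 :=
  rfl

lemma permRel_mul (σ τ : Equiv.Perm E) : permRel (σ * τ) = permRel σ * permRel τ :=
  corr_ext fun a b => ((mem_relOf_mul_permRel (permRel σ) τ a b)).symm

lemma permRel_mul_inv_mul (σ : Equiv.Perm E) (Q : End E) :
    permRel σ * (permRel σ⁻¹ * Q) = Q := by
  rw [← mul_assoc, ← permRel_mul, mul_inv_cancel, permRel_one, one_mul]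

lemma OrderOn.perm_eq_one (R : OrderOn E) {σ : Equiv.Perm E} (h : ∀ a, (σ a, a) ∈ R.1) :
    σ = 1 := by
  have pow_mem (n : ℕ) (a : E) : ((σ ^ n) a, a) ∈ R.1 := by
    induction n with
    | zero => exact R.2.1 a
    | succ n ih =>
      rw [pow_succ', Equiv.Perm.mul_apply]
      exact R.2.2.2 _ _ _ (h _) ih
  have inv_eq_pow : σ ^ (orderOf σ - 1) = σ⁻¹ :=
    eq_inv_of_mul_eq_one_left (by rw [pow_sub_one_mul (orderOf_pos σ).ne', pow_orderOf_eq_one])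
  ext a
  have := pow_mem (orderOf σ - 1) (σ a)
  rw [inv_eq_pow, ← Equiv.Perm.mul_apply, inv_mul_cancel] at this
  exact R.2.2.1 _ _ (h a) this

lemma isReflSubrel_permRel_iff (R : OrderOn E) (σ : Equiv.Perm E) :
    IsReflSubrel R (permRel σ) ↔ σ = 1 := by
  constructor
  · exact fun h => R.perm_eq_one fun a => h.2 rfl
  · rintro rfl
    refine ⟨fun _ => rfl, ?_⟩
    rintro ⟨a, b⟩ (rfl : a = b)
    exact R.2.1 a

lemma IsReflSubrel.mul {R : OrderOn E} {P Q : End E} (hP : IsReflSubrel R P)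
    (hQ : IsReflSubrel R Q) : IsReflSubrel R (P * Q) := by
  refine ⟨fun a => ⟨a, hP.1 a, hQ.1 a⟩, ?_⟩
  rintro ⟨a, c⟩ ⟨b, hab, hbc⟩
  exact R.2.2.2 _ _ _ (hP.2 hab) (hQ.2 hbc)

lemma IsReflSubrel.perm_unique {R : OrderOn E} {Q : End E} {σ τ : Equiv.Perm E}
    (hσ : IsReflSubrel R (permRel σ⁻¹ * Q)) (hτ : IsReflSubrel R (permRel τ⁻¹ * Q)) : σ = τ := by
  have : τ⁻¹ * σ = 1 := by
    refine R.perm_eq_one fun a => hτ.2 ?_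
    have := hσ.1 a
    rw [mem_relOf_permRel_mul, inv_inv] at this ⊢
    simpa using this
  exact (inv_mul_eq_one.1 this).symm

lemma isReflSubrel_op_comp_opCorr_iff (R : OrderOn E) {X : FinCorr.{u}} (P Q : E ⟶ X) :
    IsReflSubrel R.op (P ≫ opCorr Q) ↔ IsReflSubrel R (Q ≫ opCorr P) := by
  refine and_congr (forall_congr' fun a => exists_congr fun y => and_comm) ?_
  constructor
  · rintro h ⟨a, b⟩ ⟨y, hya, hyb⟩
    exact h (a := (b, a)) ⟨y, hyb, hya⟩
  · rintro h ⟨a, b⟩ ⟨y, hya, hyb⟩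
    exact h (a := (b, a)) ⟨y, hyb, hya⟩

lemma IsReflSubrel.exists_injective {R : OrderOn E} {Y : FinCorr.{u}} {A : E ⟶ Y} {B : Y ⟶ E}
    (h : IsReflSubrel R (A ≫ B)) :
    ∃ y : E → Y, Function.Injective y ∧ (∀ a, (a, y a) ∈ relOf B) ∧ ∀ a, (y a, a) ∈ relOf A := by
  choose y hB hA using h.1
  refine ⟨y, fun a b hab => ?_, hB, hA⟩
  exact R.2.2.1 _ _ (h.2 ⟨y a, hB a, hab ▸ hA b⟩) (h.2 ⟨y b, hB b, hab ▸ hA a⟩)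

lemma isReflSubrel_mul_iff (R : OrderOn E) (P Q : End E) :
    IsReflSubrel R (P * Q) ↔
      ∃ σ : Equiv.Perm E, IsReflSubrel R (P * permRel σ) ∧ IsReflSubrel R (permRel σ⁻¹ * Q) := by
  constructor
  · intro h
    obtain ⟨y, y_injective, hP, hQ⟩ := h.exists_injective
    let σ : Equiv.Perm E := Equiv.ofBijective y (Finite.injective_iff_bijective.1 y_injective)
    refine ⟨σ, ⟨fun a => ⟨y a, hP a, rfl⟩, ?_⟩, ⟨fun a => ?_, ?_⟩⟩
    · rintro ⟨a, b⟩ hab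
      rw [mem_relOf_mul_permRel] at hab
      exact h.2 ⟨y b, hab, hQ b⟩
    · rw [mem_relOf_permRel_mul, inv_inv]
      exact hQ a
    · rintro ⟨a, b⟩ hab
      rw [mem_relOf_permRel_mul, inv_inv] at hab
      exact h.2 ⟨y a, hP a, hab⟩
  · rintro ⟨σ, hP, hQ⟩
    rw [← permRel_mul_inv_mul σ Q, ← mul_assoc]
    exact hP.mul hQ

end Relations

section Inessential

variable {E : FinCorr.{u}}

lemma Inessential.mul_mul {Q : End E} (h : Inessential Q) (A B : End E) :
    Inessential (A * Q * B) := by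
  obtain ⟨Y, C, D, hY, rfl⟩ := h
  exact ⟨Y, B ≫ C, D ≫ A, hY, by simp only [End.mul_def, Category.assoc]⟩

lemma Inessential.not_isReflSubrel {Q : End E} (hQ : Inessential Q) (R : OrderOn E) :
    ¬ IsReflSubrel R Q := by
  obtain ⟨Y, A, B, hY, rfl⟩ := hQ
  intro h
  obtain ⟨y, y_injective, -⟩ := h.exists_injective
  exact hY.not_ge (Nat.card_le_card_of_injective y y_injective)

lemma inessential_of_card_image_lt (Q : End E) (A : Set E)
    (hA : {b | ∃ a ∈ A, (b, a) ∈ relOf Q}.ncard < A.ncard) : Inessential Q := by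
  classical
  set N : Set E := {b | ∃ a ∈ A, (b, a) ∈ relOf Q}
  refine ⟨⟨↥Aᶜ ⊕ N⟩,
    toHom {p | p.1.elim (fun y => y.1 = p.2) fun y => p.2 ∈ A ∧ (y.1, p.2) ∈ relOf Q},
    toHom {p | p.2.elim (fun y => (p.1, y.1) ∈ relOf Q) fun y => p.1 = y.1}, ?_, ?_⟩
  · change Nat.card (↥Aᶜ ⊕ N) < _
    rw [Nat.card_sum, Nat.card_coe_set_eq, Nat.card_coe_set_eq]
    have := Set.ncard_add_ncard_compl A
    omega
  · refine corr_ext fun z x => ⟨fun hzx => ?_, ?_⟩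
    · by_cases hx : x ∈ A
      · exact ⟨Sum.inr ⟨z, x, hx, hzx⟩, rfl, hx, hzx⟩
      · exact ⟨Sum.inl ⟨x, hx⟩, hzx, rfl⟩
    · rintro ⟨y | y, hzy, hyx⟩
      · obtain rfl : y.1 = x := hyx
        exact hzy
      · obtain rfl : z = y.1 := hzy
        exact hyx.2

lemma exists_perm_of_not_inessential {Q : End E} (hQ : ¬ Inessential Q) :
    ∃ σ : Equiv.Perm E, ∀ a, (σ a, a) ∈ relOf Q := by
  classical
  let _ := Fintype.ofFinite E
  have marriage_condition (A : Finset E) :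
      A.card ≤ ({b | ∃ a ∈ A, (b, a) ∈ relOf Q} : Finset E).card := by
    by_contra! hA
    refine hQ (inessential_of_card_image_lt Q A ?_)
    rw [← Set.ncard_coe_finset, ← Set.ncard_coe_finset, Finset.coe_filter_univ] at hA
    exact hA
  obtain ⟨f, f_injective, hf⟩ := (Fintype.all_card_le_filter_rel_iff_exists_injective
    fun a b : E => (b, a) ∈ relOf Q).1 marriage_condition
  exact ⟨Equiv.ofBijective f (Finite.injective_iff_bijective.1 f_injective), hf⟩

lemma inessential_of_preorder {Q : End E} (hrefl : ∀ a : E, (a, a) ∈ relOf Q)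
    (htrans : ∀ a b c : E, (a, b) ∈ relOf Q → (b, c) ∈ relOf Q → (a, c) ∈ relOf Q)
    {a b : E} (hab : (a, b) ∈ relOf Q) (hba : (b, a) ∈ relOf Q) (hne : a ≠ b) :
    Inessential Q := by
  classical
  refine ⟨⟨{x : E // x ≠ a}⟩, toHom {p | (p.1.1, p.2) ∈ relOf Q},
    toHom {p | (p.1, p.2.1) ∈ relOf Q}, Finite.card_subtype_lt (x := a) (by simp),
    corr_ext fun z x => ⟨fun hzx => ?_, ?_⟩⟩
  · by_cases hz : z = a
    · subst hz
      exact ⟨⟨b, hne.symm⟩, hab, htrans _ _ _ hba hzx⟩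
    · exact ⟨⟨z, hz⟩, hrefl z, hzx⟩
  · rintro ⟨y, hzy, hyx⟩
    exact htrans _ _ _ hzy hyx

end Inessential

section TransClosure

variable {E : FinCorr.{u}}

lemma relOf_transClosure_subset_iff {Q : End E} {S : SetRel E E}
    (hS : ∀ a b c, (a, b) ∈ S → (b, c) ∈ S → (a, c) ∈ S) :
    relOf (transClosure Q) ⊆ S ↔ relOf Q ⊆ S := by
  refine ⟨fun h p hp => h (Relation.TransGen.single hp), ?_⟩
  rintro h ⟨a, b⟩ (hab : Relation.TransGen _ a b)
  induction hab with
  | single hab => exact h hab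
  | tail _ hbc ih => exact hS _ _ _ ih (h hbc)

lemma isReflSubrel_conj_iff {Q : End E} (hQ : ∀ a : E, (a, a) ∈ relOf Q) (R : OrderOn E)
    (σ τ : Equiv.Perm E) :
    IsReflSubrel R (permRel σ⁻¹ * Q * permRel τ) ↔
      σ = τ ∧ relOf Q ⊆ {p | (σ⁻¹ p.1, σ⁻¹ p.2) ∈ R.1} := by
  simp only [IsReflSubrel, mem_relOf_mul_permRel, mem_relOf_permRel_mul, inv_inv]
  constructor
  · rintro ⟨-, h⟩
    have mem_of_mem {a b : E} (hab : (σ a, τ b) ∈ relOf Q) : (a, b) ∈ R.1 :=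
      h (by rwa [mem_relOf_mul_permRel, mem_relOf_permRel_mul, inv_inv])
    obtain rfl : σ = τ := by
      refine (inv_mul_eq_one.1 (R.perm_eq_one fun b => mem_of_mem ?_))
      simpa using hQ (τ b)
    refine ⟨rfl, fun p hp => mem_of_mem ?_⟩
    simpa using hp
  · rintro ⟨rfl, h⟩
    refine ⟨fun a => hQ _, ?_⟩
    rintro ⟨a, b⟩ hab
    rw [mem_relOf_mul_permRel, mem_relOf_permRel_mul, inv_inv] at hab
    simpa using h hab

lemma isReflSubrel_conj_transClosure_iff {Q : End E} (hQ : ∀ a : E, (a, a) ∈ relOf Q)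
    (R : OrderOn E) (σ τ : Equiv.Perm E) :
    IsReflSubrel R (permRel σ⁻¹ * transClosure Q * permRel τ) ↔
      IsReflSubrel R (permRel σ⁻¹ * Q * permRel τ) := by
  have hQ' (a : E) : (a, a) ∈ relOf (transClosure Q) := Relation.TransGen.single (hQ a)
  rw [isReflSubrel_conj_iff hQ, isReflSubrel_conj_iff hQ']
  exact and_congr_right fun _ => relOf_transClosure_subset_iff fun _ _ _ => R.2.2.2 _ _ _

end TransClosure

/-! ### The left ideal generated by `f_R` -/

section PermOrderAlg

variable {k : Type v} [CommRing k] {E : FinCorr.{u}}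

lemma permOrderMk_of_inessential {Q : End E} (hQ : Inessential Q) : permOrderMk k E Q = 0 := by
  have := RingQuot.mkAlgHom_rel k (PermOrderRel.inessential (k := k) Q hQ)
  rwa [map_zero] at this

lemma permOrderMk_transClosure {Q : End E} (hQ : ∀ a : E, (a, a) ∈ relOf Q) :
    permOrderMk k E (transClosure Q) = permOrderMk k E Q :=
  (RingQuot.mkAlgHom_rel k (PermOrderRel.closure (k := k) Q hQ)).symm

lemma span_range_permOrderMk : Submodule.span k (Set.range (permOrderMk k E)) = ⊤ := by
  rw [eq_top_iff]
  rintro x -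
  obtain ⟨a, rfl⟩ := RingQuot.mkAlgHom_surjective k (PermOrderRel k E) x
  induction a using MonoidAlgebra.induction_on with
  | of Q => exact Submodule.subset_span ⟨Q, rfl⟩
  | add a b ha hb => rw [map_add]; exact Submodule.add_mem _ ha hb
  | smul c a ha => rw [map_smul]; exact Submodule.smul_mem _ c ha

open Classical in
lemma fIdem_eq_sum [Fintype (OrderOn E)] [LocallyFiniteOrder (OrderOn E)] (R : OrderOn E) :
    fIdem k R =
      ∑ S : OrderOn E with R ≤ S, IncidenceAlgebra.mu k R S • permOrderMk k E (toHom S.1) := by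
  unfold fIdem
  congr!
  exact Subsingleton.elim _ _

open Classical in
lemma permOrderMk_order [Fintype (OrderOn E)] (R : OrderOn E) :
    permOrderMk k E (toHom R.1) = ∑ S : OrderOn E with R ≤ S, fIdem k S := by
  let _ : LocallyFiniteOrder (OrderOn E) := Fintype.toLocallyFiniteOrder
  simp only [fIdem_eq_sum]
  exact (sum_upper_sum_mu_smul (fun S : OrderOn E => permOrderMk k E (toHom S.1)) R).symm

open Classical in
lemma permOrderMk_eq_sum_fIdem [Fintype (OrderOn E)] {Q : End E}
    (hQ : ∀ a : E, (a, a) ∈ relOf Q) :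
    permOrderMk k E Q = ∑ S : OrderOn E with relOf Q ⊆ S.1, fIdem k S := by
  have hrefl (a : E) : (a, a) ∈ relOf (transClosure Q) := Relation.TransGen.single (hQ a)
  have htrans (a b c : E) (hab : (a, b) ∈ relOf (transClosure Q))
      (hbc : (b, c) ∈ relOf (transClosure Q)) : (a, c) ∈ relOf (transClosure Q) :=
    Relation.TransGen.trans hab hbc
  have closure_subset (S : OrderOn E) : relOf (transClosure Q) ⊆ S.1 ↔ relOf Q ⊆ S.1 :=
    relOf_transClosure_subset_iff S.2.2.2
  rw [← permOrderMk_transClosure hQ]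
  by_cases hanti : ∀ a b : E, (a, b) ∈ relOf (transClosure Q) →
      (b, a) ∈ relOf (transClosure Q) → a = b
  · refine (permOrderMk_order ⟨relOf (transClosure Q), hrefl, hanti, htrans⟩).trans ?_
    exact Finset.sum_congr (Finset.filter_congr fun S _ => closure_subset S) fun _ _ => rfl
  · push Not at hanti
    obtain ⟨a, b, hab, hba, hne⟩ := hanti
    rw [permOrderMk_of_inessential (inessential_of_preorder hrefl htrans hab hba hne),
      Finset.sum_eq_zero]
    intro S hS
    have hQS := (closure_subset S).2 (Finset.mem_filter.1 hS).2
    exact absurd (S.2.2.1 a b (hQS hab) (hQS hba)) hne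

open Classical in
lemma permOrderMk_mul_fIdem_of_refl {Q : End E} (hQ : ∀ a : E, (a, a) ∈ relOf Q)
    (R : OrderOn E) :
    permOrderMk k E Q * fIdem k R = if relOf Q ⊆ R.1 then fIdem k R else 0 := by
  let _ := Fintype.ofFinite (OrderOn E)
  refine congrFun (eq_of_sum_upper_eq (f := fun R => permOrderMk k E Q * fIdem k R)
    (g := fun R => if relOf Q ⊆ R.1 then fIdem k R else 0) fun S => ?_) R
  let P : End E := toHom S.1
  have comp_subset_iff (U : OrderOn E) :
      relOf (Q * P) ⊆ U.1 ↔ S ≤ U ∧ relOf Q ⊆ U.1 := by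
    constructor
    · exact fun h => ⟨fun p hp => h ⟨p.1, hQ p.1, hp⟩, fun p hp => h ⟨p.2, hp, S.2.1 p.2⟩⟩
    · rintro ⟨hS, hQ⟩ ⟨a, c⟩ ⟨b, hab, hbc⟩
      exact U.2.2.2 _ _ _ (hQ hab) (hS hbc)
  calc ∑ U with S ≤ U, permOrderMk k E Q * fIdem k U
      = permOrderMk k E (Q * P) := by
        rw [← Finset.mul_sum, ← permOrderMk_order, map_mul]
    _ = ∑ U : OrderOn E with S ≤ U ∧ relOf Q ⊆ U.1, fIdem k U := by
        have comp_refl (a : E) : (a, a) ∈ relOf (Q * P) := ⟨a, hQ a, S.2.1 a⟩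
        rw [permOrderMk_eq_sum_fIdem comp_refl]
        simp only [comp_subset_iff]
    _ = ∑ U with S ≤ U, if relOf Q ⊆ U.1 then fIdem k U else 0 := by
        rw [← Finset.sum_filter, Finset.filter_filter]

lemma IsReflSubrel.permOrderMk_mul_fIdem {R : OrderOn E} {Q : End E} {σ : Equiv.Perm E}
    (h : IsReflSubrel R (permRel σ⁻¹ * Q)) :
    permOrderMk k E Q * fIdem k R = permOrderMk k E (permRel σ) * fIdem k R := by
  rw [← permRel_mul_inv_mul σ Q, map_mul, mul_assoc, permOrderMk_mul_fIdem_of_refl h.1,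
    if_pos h.2]

lemma permOrderMk_mul_fIdem_eq_zero {R : OrderOn E} {Q : End E}
    (h : ∀ σ : Equiv.Perm E, ¬ IsReflSubrel R (permRel σ⁻¹ * Q)) :
    permOrderMk k E Q * fIdem k R = 0 := by
  by_cases hQ : Inessential Q
  · rw [permOrderMk_of_inessential hQ, zero_mul]
  · obtain ⟨σ, hσ⟩ := exists_perm_of_not_inessential hQ
    have hrefl (a : E) : (a, a) ∈ relOf (permRel σ⁻¹ * Q) := by
      rw [mem_relOf_permRel_mul, inv_inv]
      exact hσ a
    rw [← permRel_mul_inv_mul σ Q, map_mul, mul_assoc, permOrderMk_mul_fIdem_of_refl hrefl,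
      if_neg fun hR => h σ ⟨hrefl, hR⟩, mul_zero]

section Matrix

variable [Fintype E] [DecidableEq E]

open Classical in
/-- The matrix with entries `1` where `Δ ⊆ Δ_σ⁻¹ Q Δ_τ ⊆ R` and `0` elsewhere. This is the matrix
of `Q` acting on `𝒫_E f_R` with respect to the basis `Δ_σ f_R`. -/
def relMatrix (k : Type v) [CommRing k] (R : OrderOn E) :
    End E →* Matrix (Equiv.Perm E) (Equiv.Perm E) k where
  toFun Q := Matrix.of fun σ τ => if IsReflSubrel R (permRel σ⁻¹ * Q * permRel τ) then 1 else 0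
  map_one' := by
    ext σ τ
    simp only [Matrix.of_apply, mul_one, ← permRel_mul, isReflSubrel_permRel_iff, inv_mul_eq_one,
      Matrix.one_apply]
  map_mul' P Q := by
    ext σ τ
    simp only [Matrix.mul_apply, Matrix.of_apply, mul_ite, mul_one, mul_zero, ← ite_and]
    have entry_iff : IsReflSubrel R (permRel σ⁻¹ * (P * Q) * permRel τ) ↔
        ∃ ρ, IsReflSubrel R (permRel ρ⁻¹ * Q * permRel τ) ∧
          IsReflSubrel R (permRel σ⁻¹ * P * permRel ρ) := by
      rw [← mul_assoc, mul_assoc, isReflSubrel_mul_iff]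
      simp only [mul_assoc, and_comm]
    by_cases h : IsReflSubrel R (permRel σ⁻¹ * (P * Q) * permRel τ)
    · obtain ⟨ρ, hQ, hP⟩ := entry_iff.1 h
      rw [if_pos h, Finset.sum_eq_single ρ _ (by simp), if_pos ⟨hQ, hP⟩]
      refine fun ρ' _ hne => if_neg fun hρ' => hne ?_
      rw [mul_assoc] at hQ hρ'
      exact hρ'.1.perm_unique hQ
    · rw [if_neg h, Finset.sum_eq_zero]
      exact fun ρ _ => if_neg fun hρ => h (entry_iff.2 ⟨ρ, hρ⟩)

/-- The matrix of the left multiplication by an element of `𝒫_E` on `𝒫_E f_R`, with respect to the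
basis `Δ_σ f_R`. -/
def permOrderMatrix (k : Type v) [CommRing k] (R : OrderOn E) :
    PermOrderAlg k E →ₐ[k] Matrix (Equiv.Perm E) (Equiv.Perm E) k :=
  RingQuot.liftAlgHom k ⟨MonoidAlgebra.lift k _ _ (relMatrix k R), fun x y h => by
    cases h with
    | inessential Q hQ =>
      rw [MonoidAlgebra.lift_of, map_zero]
      ext σ τ
      exact if_neg ((hQ.mul_mul _ _).not_isReflSubrel R)
    | closure Q hQ =>
      rw [MonoidAlgebra.lift_of, MonoidAlgebra.lift_of]
      ext σ τ
      classical
      exact if_congr (isReflSubrel_conj_transClosure_iff hQ R σ τ).symm rfl rfl⟩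

open Classical in
lemma permOrderMatrix_permOrderMk (R : OrderOn E) (Q : End E) (σ τ : Equiv.Perm E) :
    permOrderMatrix k R (permOrderMk k E Q) σ τ =
      if IsReflSubrel R (permRel σ⁻¹ * Q * permRel τ) then 1 else 0 := by
  have : permOrderMatrix k R (permOrderMk k E Q) = relMatrix k R Q :=
    (RingQuot.liftAlgHom_mkAlgHom_apply k _ _ _).trans (MonoidAlgebra.lift_of _ _)
  rw [this]
  rfl

lemma permOrderMatrix_fIdem (R : OrderOn E) (σ : Equiv.Perm E) :
    permOrderMatrix k R (fIdem k R) σ 1 = if σ = 1 then 1 else 0 := by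
  classical
  let _ := Fintype.ofFinite (OrderOn E)
  let _ : LocallyFiniteOrder (OrderOn E) := Fintype.toLocallyFiniteOrder
  have entry (S : OrderOn E) (hS : R ≤ S) :
      permOrderMatrix k R (permOrderMk k E (toHom S.1)) σ 1 = if R = S ∧ σ = 1 then 1 else 0 := by
    rw [permOrderMatrix_permOrderMk]
    refine if_congr ((isReflSubrel_conj_iff S.2.1 R σ 1).trans ?_) rfl rfl
    rw [and_comm]
    refine and_congr_left ?_
    rintro rfl
    exact ⟨fun h => le_antisymm hS h, fun h => h.ge⟩
  simp only [fIdem_eq_sum, map_sum, map_smul, Matrix.sum_apply, Matrix.smul_apply, smul_eq_mul]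
  rw [Finset.sum_congr rfl fun S hS => by rw [entry S (Finset.mem_filter.1 hS).2],
    Finset.sum_eq_single_of_mem R (by simp) fun S _ hne => by simp [hne.symm]]
  simp

lemma permOrderMatrix_mul_fIdem (R : OrderOn E) (a : PermOrderAlg k E) (σ : Equiv.Perm E) :
    permOrderMatrix k R (a * fIdem k R) σ 1 = permOrderMatrix k R a σ 1 := by
  simp [Matrix.mul_apply, permOrderMatrix_fIdem]

lemma mul_fIdem_eq_sum (R : OrderOn E) (a : PermOrderAlg k E) :
    a * fIdem k R = ∑ σ : Equiv.Perm E,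
      permOrderMatrix k R a σ 1 • (permOrderMk k E (permRel σ) * fIdem k R) := by
  classical
  have ha : a ∈ Submodule.span k (Set.range (permOrderMk k E)) :=
    span_range_permOrderMk (k := k) (E := E) ▸ Submodule.mem_top
  induction ha using Submodule.span_induction with
  | mem a ha =>
    obtain ⟨Q, rfl⟩ := ha
    simp only [permOrderMatrix_permOrderMk, permRel_one, mul_one, ite_smul, one_smul, zero_smul]
    by_cases h : ∃ σ : Equiv.Perm E, IsReflSubrel R (permRel σ⁻¹ * Q)
    · obtain ⟨σ, hσ⟩ := h
      rw [Finset.sum_eq_single_of_mem σ (Finset.mem_univ σ) fun τ _ hne =>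
        if_neg fun hτ => hne (hτ.perm_unique hσ), if_pos hσ, hσ.permOrderMk_mul_fIdem]
    · push Not at h
      rw [permOrderMk_mul_fIdem_eq_zero h, Finset.sum_eq_zero fun σ _ => if_neg (h σ)]
  | zero => simp
  | add a b _ _ ha hb => simp [add_mul, add_smul, Finset.sum_add_distrib, ha, hb]
  | smul c a _ ha => simp [mul_smul, Finset.smul_sum, ha]

lemma mul_fIdem_eq_zero_iff (R : OrderOn E) (a : PermOrderAlg k E) :
    a * fIdem k R = 0 ↔ ∀ σ : Equiv.Perm E, permOrderMatrix k R a σ 1 = 0 := by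
  constructor
  · intro h σ
    rw [← permOrderMatrix_mul_fIdem, h, map_zero, Matrix.zero_apply]
  · intro h
    rw [mul_fIdem_eq_sum, Finset.sum_eq_zero fun σ _ => by rw [h σ, zero_smul]]

end Matrix

lemma span_range_fundRep_permRel (R : OrderOn E) :
    Submodule.span k (Set.range fun σ : Equiv.Perm E => fundRep k R (permRel σ) (fGen k R)) =
      ⊤ := by
  classical
  let _ := Fintype.ofFinite E
  refine eq_top_iff.2 fun w _ => ?_
  obtain ⟨a, ha⟩ := Ideal.mem_span_singleton'.1 w.2
  have w_eq : w = ∑ σ : Equiv.Perm E,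
      permOrderMatrix k R a σ 1 • fundRep k R (permRel σ) (fGen k R) := by
    refine Subtype.ext (ha.symm.trans ((mul_fIdem_eq_sum R a).trans ?_))
    rw [AddSubmonoidClass.coe_finsetSum]
    rfl
  rw [w_eq]
  exact Submodule.sum_smul_mem _ _ fun σ _ => Submodule.subset_span ⟨σ, rfl⟩

end PermOrderAlg

/-! ### Functors generated by one element -/

section Generated

lemma exists_comp_eq_of_ker_le {k M N P : Type*} [Ring k] [AddCommGroup M] [AddCommGroup N]
    [AddCommGroup P] [Module k M] [Module k N] [Module k P] {p : M →ₗ[k] N}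
    (hp : Function.Surjective p) {f : M →ₗ[k] P} (h : LinearMap.ker p ≤ LinearMap.ker f) :
    ∃ g : N →ₗ[k] P, g ∘ₗ p = f := by
  refine ⟨(LinearMap.ker p).liftQ f h ∘ₗ (p.quotKerEquivOfSurjective hp).symm, ?_⟩
  ext x
  have : (p.quotKerEquivOfSurjective hp).symm (p x) = (LinearMap.ker p).mkQ x :=
    (LinearEquiv.symm_apply_eq _).2 rfl
  simp [this]

variable {k : Type v} [CommRing k] {E : FinCorr.{u}} {F F' : CorrFunctor.{u} k}

/-- The morphism from the representable functor `k𝒞(-,E)` to `F` corresponding to `g ∈ F(E)`,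
evaluated at `X`. -/
def genMap (g : F.obj E) (X : FinCorr.{u}) : ((E ⟶ X) →₀ k) →ₗ[k] F.obj X :=
  Finsupp.linearCombination k fun φ : E ⟶ X => F.map φ g

lemma genMap_single (g : F.obj E) {X : FinCorr.{u}} (φ : E ⟶ X) :
    genMap g X (Finsupp.single φ 1) = F.map φ g := by
  rw [genMap, Finsupp.linearCombination_single, one_smul]

lemma app_genMap (θ : F ⟶ F') (g : F.obj E) (X : FinCorr.{u}) (u : (E ⟶ X) →₀ k) :
    θ.app X (genMap g X u) = genMap (θ.app E g) X u := by
  refine (Finsupp.apply_linearCombination k (θ.app X).hom _ u).trans ?_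
  exact congrArg (Finsupp.linearCombination k · u)
    (funext fun φ => NatTrans.naturality_apply θ φ g)

lemma map_genMap (g : F.obj E) {X Y : FinCorr.{u}} (Q : X ⟶ Y) (u : (E ⟶ X) →₀ k) :
    F.map Q (genMap g X u) = genMap g Y (Finsupp.lmapDomain k k (· ≫ Q) u) := by
  refine (Finsupp.apply_linearCombination k (F.map Q).hom _ u).trans ?_
  rw [genMap, Finsupp.lmapDomain_apply, Finsupp.linearCombination_mapDomain]
  exact congrArg (Finsupp.linearCombination k · u)
    (funext fun φ => (ConcreteCategory.congr_hom (F.map_comp φ Q) g).symm)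

/-- `F` is generated by `g`, that is, every element of every `F(X)` is a linear combination of
images of `g` under correspondences. -/
def Generates (g : F.obj E) : Prop :=
  ∀ X : FinCorr.{u}, Function.Surjective (genMap g X)

lemma Generates.hom_ext {g : F.obj E} (hg : Generates g) {θ θ' : F ⟶ F'}
    (h : θ.app E g = θ'.app E g) : θ = θ' := by
  ext X x
  obtain ⟨u, rfl⟩ := hg X x
  change θ.app X _ = θ'.app X _
  rw [app_genMap, app_genMap, h]

lemma Generates.exists_hom {g : F.obj E} (hg : Generates g) (g' : F'.obj E)
    (h : ∀ (X : FinCorr.{u}) (u : (E ⟶ X) →₀ k), genMap g X u = 0 → genMap g' X u = 0) :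
    ∃ θ : F ⟶ F', θ.app E g = g' := by
  choose f hf using fun X => exists_comp_eq_of_ker_le (hg X) (f := genMap g' X) (h X)
  have apply_genMap (X : FinCorr.{u}) (u : (E ⟶ X) →₀ k) : f X (genMap g X u) = genMap g' X u :=
    LinearMap.congr_fun (hf X) u
  refine ⟨{ app := fun X => ModuleCat.ofHom (f X), naturality := fun X Y Q => ?_ }, ?_⟩
  · ext x
    obtain ⟨u, rfl⟩ := hg X x
    change f Y (F.map Q (genMap g X u)) = F'.map Q (f X (genMap g X u))
    rw [map_genMap, apply_genMap, apply_genMap, map_genMap]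
  · have := apply_genMap E (Finsupp.single (𝟙 E) 1)
    rw [genMap_single, genMap_single, F.map_id, F'.map_id] at this
    exact this

lemma Generates.surjective_of_app_eq {g' : F'.obj E} (hg' : Generates g') {θ : F ⟶ F'}
    {g : F.obj E} (h : θ.app E g = g') (X : FinCorr.{u}) : Function.Surjective (θ.app X) := by
  intro x
  obtain ⟨u, rfl⟩ := hg' X x
  exact ⟨genMap g X u, by rw [app_genMap, h]⟩

lemma exists_iso_of_bijective (θ : F ⟶ F') (h : ∀ X, Function.Bijective (θ.app X)) :
    ∃ i : F ≅ F', i.hom = θ := by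
  have (X : FinCorr.{u}) : IsIso (θ.app X) :=
    (ConcreteCategory.isIso_iff_bijective (θ.app X)).2 (h X)
  have : IsIso θ := NatIso.isIso_of_isIso_app θ
  exact ⟨asIso θ, rfl⟩

lemma Generates.exists_iso {g : F.obj E} {g' : F'.obj E} (hg : Generates g) (hg' : Generates g')
    (h : ∀ (X : FinCorr.{u}) (u : (E ⟶ X) →₀ k), genMap g X u = 0 ↔ genMap g' X u = 0) :
    ∃ i : F ≅ F', i.hom.app E g = g' := by
  obtain ⟨θ, hθ⟩ := hg.exists_hom g' fun X u => (h X u).1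
  have injective (X : FinCorr.{u}) : Function.Injective (θ.app X) := by
    refine (injective_iff_map_eq_zero (θ.app X).hom).2 fun x hx => ?_
    obtain ⟨u, rfl⟩ := hg X x
    change θ.app X _ = 0 at hx
    rw [app_genMap, hθ] at hx
    exact (h X u).2 hx
  obtain ⟨i, rfl⟩ :=
    exists_iso_of_bijective θ fun X => ⟨injective X, hg'.surjective_of_app_eq hθ X⟩
  exact ⟨i, hθ⟩

lemma generates_gen (g : F.obj E) :
    Generates (F := (Sub.gen g).toFunctor) (⟨g, Sub.mem_gen g⟩ : (Sub.gen g).obj E) := by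
  rintro X ⟨x, hx⟩
  obtain ⟨u, rfl⟩ := Finsupp.mem_span_range_iff_exists_finsupp.1 hx
  exact ⟨u, Subtype.ext (app_genMap (Sub.gen g).incl ⟨g, Sub.mem_gen g⟩ X u)⟩

end Generated

/-! ### The functors `L_{E,W} / J_{E,W}` -/

section QuotTmul

variable {k : Type v} [CommRing k] {E : FinCorr.{u}} {W : Type max u v} [AddCommGroup W]
  [Module k W] (ρ : Representation k (End E) W)

/-- The linear map `W → (L_{E,W} / J_{E,W})(X)` sending `w` to the class of `φ ⊗ w`. -/
def quotTmul {X : FinCorr.{u}} (φ : E ⟶ X) : W →ₗ[k] (JSub ρ).quot.obj X :=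
  ((JSub ρ).proj.app X).hom ∘ₗ (balanced ρ X).mkQ ∘ₗ Finsupp.lsingle φ

lemma map_quotTmul {X Y : FinCorr.{u}} (Q : X ⟶ Y) (φ : E ⟶ X) (w : W) :
    (JSub ρ).quot.map Q (quotTmul ρ φ w) = quotTmul ρ (φ ≫ Q) w :=
  congrArg ((JSub ρ).obj Y).mkQ (congrArg (balanced ρ Y).mkQ (postcomp_single Q φ w))

lemma quotTmul_rho {X : FinCorr.{u}} (φ : E ⟶ X) (Q : End E) (w : W) :
    quotTmul ρ φ (ρ Q w) = quotTmul ρ (Q ≫ φ : E ⟶ X) w := by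
  have tmul_eq : LFun.tmul ρ (Q ≫ φ : E ⟶ X) w = LFun.tmul ρ φ (ρ Q w) :=
    (Submodule.Quotient.eq _).2 (Submodule.subset_span ⟨φ, Q, w, rfl⟩)
  exact congrArg ((JSub ρ).obj X).mkQ tmul_eq.symm

lemma iSup_range_quotTmul (X : FinCorr.{u}) :
    ⨆ φ : E ⟶ X, LinearMap.range (quotTmul ρ φ) = ⊤ := by
  let π : ((E ⟶ X) →₀ W) →ₗ[k] (JSub ρ).quot.obj X :=
    ((JSub ρ).proj.app X).hom ∘ₗ (balanced ρ X).mkQ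
  have π_surjective : Function.Surjective π :=
    ((JSub ρ).obj X).mkQ_surjective.comp (Submodule.mkQ_surjective _)
  calc ⨆ φ : E ⟶ X, LinearMap.range (quotTmul ρ φ)
      = ⨆ φ : E ⟶ X, (LinearMap.range (Finsupp.lsingle φ)).map π :=
        iSup_congr fun φ => LinearMap.range_comp _ π
    _ = ⊤ := by
        rw [← Submodule.map_iSup, Finsupp.iSup_lsingle_range, Submodule.map_top,
          LinearMap.range_eq_top.2 π_surjective]

lemma generates_quotTmul {w : W} (hw : Submodule.span k (Set.range fun Q => ρ Q w) = ⊤) :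
    Generates (quotTmul ρ (𝟙 E) w) := by
  intro X
  rw [← LinearMap.range_eq_top, eq_top_iff, ← iSup_range_quotTmul]
  refine iSup_le fun φ => ?_
  rw [LinearMap.range_eq_map, ← hw, Submodule.map_span_le]
  rintro _ ⟨Q, rfl⟩
  refine ⟨Finsupp.single (Q ≫ φ) 1, ?_⟩
  rw [genMap_single, map_quotTmul, Category.id_comp, quotTmul_rho]

lemma genMap_quotTmul_eq_zero_iff (w : W) {X : FinCorr.{u}} (u : (E ⟶ X) →₀ k) :
    genMap (quotTmul ρ (𝟙 E) w) X u = 0 ↔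
      ∀ ψ : X ⟶ E, Finsupp.linearCombination k (fun φ : E ⟶ X => ρ (φ ≫ ψ : E ⟶ E) w) u = 0 := by
  let tmulSum : (LFun ρ).obj X := Finsupp.linearCombination k (fun φ => LFun.tmul ρ φ w) u
  have genMap_eq : genMap (quotTmul ρ (𝟙 E) w) X u = ((JSub ρ).obj X).mkQ tmulSum := by
    refine Eq.trans ?_ (Finsupp.apply_linearCombination k ((JSub ρ).obj X).mkQ _ u).symm
    refine congrArg (Finsupp.linearCombination k · u) (funext fun φ => ?_)
    rw [map_quotTmul, Category.id_comp]
    rfl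
  have eval_eq (ψ : X ⟶ E) : LFun.eval ρ ψ tmulSum =
      Finsupp.linearCombination k (fun φ : E ⟶ X => ρ (φ ≫ ψ : E ⟶ E) w) u := by
    refine (Finsupp.apply_linearCombination k (LFun.eval ρ ψ) _ u).trans ?_
    exact congrArg (Finsupp.linearCombination k · u) (funext fun φ => LFun.eval_tmul ρ ψ φ w)
  rw [genMap_eq]
  refine (Submodule.Quotient.mk_eq_zero _).trans ((Submodule.mem_iInf _).trans ?_)
  exact forall_congr' fun ψ => by rw [LinearMap.mem_ker, eval_eq]

end QuotTmul

/-! ### The fundamental functors -/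

section FundFunctor

variable {k : Type v} [CommRing k] {E : FinCorr.{u}} (R : OrderOn E)

open Classical in
/-- The linear form on `k𝒞(X,E)` sending `φ` to `1` if `Δ ⊆ ψφ ⊆ R` and to `0` otherwise. -/
def orderForm (k : Type v) [CommRing k] (R : OrderOn E) {X : FinCorr.{u}} (ψ : X ⟶ E) :
    ((E ⟶ X) →₀ k) →ₗ[k] k :=
  Finsupp.linearCombination k fun φ : E ⟶ X =>
    if IsReflSubrel R (φ ≫ ψ : E ⟶ E) then (1 : k) else 0

/-- The element `f_R` of `𝕊_{E,R}(E)`. -/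
def fundGen (k : Type v) [CommRing k] (R : OrderOn E) : (fundFunctor k R).obj E :=
  fundEval k R (fGen k R)

lemma generates_fundGen : Generates (fundGen k R) := by
  refine generates_quotTmul (fundRep k R) (eq_top_iff.2 ?_)
  rw [← span_range_fundRep_permRel]
  exact Submodule.span_mono (Set.range_comp_subset_range permRel fun Q => fundRep k R Q (fGen k R))

lemma fundEval_fundRep (Q : End E) :
    fundEval k R (fundRep k R Q (fGen k R)) = (fundFunctor k R).map Q (fundGen k R) := by
  refine (quotTmul_rho (fundRep k R) (𝟙 E) Q (fGen k R)).trans ?_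
  refine Eq.trans ?_ (map_quotTmul (fundRep k R) Q (𝟙 E) (fGen k R)).symm
  rw [Category.comp_id, Category.id_comp]

lemma permOrderMatrix_linearCombination [Fintype E] [DecidableEq E] {X : FinCorr.{u}}
    (ψ : X ⟶ E) (u : (E ⟶ X) →₀ k) (σ : Equiv.Perm E) :
    permOrderMatrix k R
        (Finsupp.linearCombination k (fun φ : E ⟶ X => permOrderMk k E (φ ≫ ψ : E ⟶ E)) u) σ 1 =
      orderForm k R (ψ ≫ permRel σ⁻¹) u := by
  let entry : PermOrderAlg k E →ₗ[k] k :=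
    Matrix.entryLinearMap k k σ 1 ∘ₗ (permOrderMatrix k R).toLinearMap
  refine (Finsupp.apply_linearCombination k entry _ u).trans ?_
  refine congrArg (Finsupp.linearCombination k · u) (funext fun φ => ?_)
  refine (permOrderMatrix_permOrderMk R _ σ 1).trans ?_
  rw [permRel_one, mul_one, End.mul_def, Category.assoc]

lemma genMap_fundGen_eq_zero_iff {X : FinCorr.{u}} (u : (E ⟶ X) →₀ k) :
    genMap (fundGen k R) X u = 0 ↔ ∀ ψ : X ⟶ E, orderForm k R ψ u = 0 := by
  classical
  let _ := Fintype.ofFinite E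
  let combination (ψ : X ⟶ E) : PermOrderAlg k E :=
    Finsupp.linearCombination k (fun φ : E ⟶ X => permOrderMk k E (φ ≫ ψ : E ⟶ E)) u
  have coe_linearCombination (ψ : X ⟶ E) :
      ((Finsupp.linearCombination k (fun φ : E ⟶ X => fundRep k R (φ ≫ ψ : E ⟶ E) (fGen k R)) u :
        FundMod k R) : PermOrderAlg k E) = combination ψ * fIdem k R := by
    let incl := (Submodule.subtype (Ideal.span {fIdem k R})).restrictScalars k
    exact (Finsupp.apply_linearCombination k incl _ u).trans
      (Finsupp.apply_linearCombination k (LinearMap.mulRight k (fIdem k R)) _ u).symm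
  refine (genMap_quotTmul_eq_zero_iff (fundRep k R) (fGen k R) u).trans ?_
  simp only [← Submodule.coe_eq_zero, coe_linearCombination, mul_fIdem_eq_zero_iff, combination,
    permOrderMatrix_linearCombination]
  refine ⟨fun h ψ => ?_, fun h ψ σ => h _⟩
  have := h ψ 1
  rwa [inv_one, permRel_one, End.one_def, Category.comp_id] at this

lemma dual_fundFunctor_ext {α α' : (dual (fundFunctor k R)).obj E}
    (h : ∀ σ : Equiv.Perm E,
      dualApply α (fundEval k R (fundRep k R (permRel σ) (fGen k R))) =
        dualApply α' (fundEval k R (fundRep k R (permRel σ) (fGen k R)))) : α = α' := by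
  let eval : FundMod k R →ₗ[k] (fundFunctor k R).obj E := quotTmul (fundRep k R) (𝟙 E)
  let form (β : (dual (fundFunctor k R)).obj E) : Module.Dual k ((fundFunctor k R).obj E) := β
  have comp_eval_eq : form α ∘ₗ eval = form α' ∘ₗ eval :=
    LinearMap.ext_on_range (span_range_fundRep_permRel R) h
  have comp_genMap_eq : form α ∘ₗ genMap (fundGen k R) E = form α' ∘ₗ genMap (fundGen k R) E := by
    refine Finsupp.lhom_ext' fun Q => LinearMap.ext_ring ?_
    change form α (genMap _ E (Finsupp.single Q 1)) = form α' (genMap _ E (Finsupp.single Q 1))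
    rw [genMap_single, ← fundEval_fundRep]
    exact LinearMap.congr_fun comp_eval_eq (fundRep k R Q (fGen k R))
  exact (LinearMap.cancel_right (generates_fundGen R E)).1 comp_genMap_eq

variable {R} in
lemma IsCanonical.eq {α α' : fundFunctor k R ⟶ dual (fundFunctor k R.op)}
    (hα : IsCanonical k R α) (hα' : IsCanonical k R α') : α = α' :=
  (generates_fundGen R).hom_ext
    (dual_fundFunctor_ext R.op fun σ => (hα σ).trans (hα' σ).symm)

end FundFunctor

/-! ### The functor of a lattice -/

section Pairing

variable {k : Type v} [CommRing k] {T : Type u} [Lattice T] [BoundedOrder T] {X : FinCorr.{u}}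

lemma FT.map_of {Y : FinCorr.{u}} (Q : X ⟶ Y) (φ : X → T) :
    (FT k T).map Q (FT.of k φ) = FT.of k (act Q φ) :=
  Finsupp.mapDomain_single

lemma FT.lhom_ext {M : Type*} [AddCommGroup M] [Module k M] {f g : (FT k T).obj X →ₗ[k] M}
    (h : ∀ φ : X → T, f (FT.of k φ) = g (FT.of k φ)) : f = g :=
  Finsupp.lhom_ext' fun φ => LinearMap.ext_ring (h φ)

lemma FT.span_range_of : Submodule.span k (Set.range fun φ : X → T => FT.of k φ) = ⊤ :=
  Finsupp.basisSingleOne.span_eq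

open Classical in
lemma pairing_of_of (φ : X → T) (ψ : X → Tᵒᵈ) :
    pairing k T X (FT.of k φ) (FT.of k ψ) =
      if ∀ x, φ x ≤ OrderDual.ofDual (ψ x) then 1 else 0 := by
  change prePairing k T X (Finsupp.single φ 1) (Finsupp.single ψ 1) = _
  simp [prePairing]

open Classical in
lemma pairing_of_apply [Fintype (X → T)] (φ : X → T) (w : (X → Tᵒᵈ) →₀ k) :
    pairing k T X (FT.of k φ) w = ∑ ψ : X → T with φ ≤ ψ, w (OrderDual.toDual ∘ ψ) := by
  change prePairing k T X (Finsupp.single φ 1) w = _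
  let _ : Fintype (X → Tᵒᵈ) := inferInstanceAs (Fintype (X → T))
  let e : (X → Tᵒᵈ) ≃ (X → T) := Equiv.refl _
  rw [prePairing, Finsupp.linearCombination_single, one_smul, Finsupp.linearCombination_apply,
    Finsupp.sum_fintype _ _ fun _ => by exact zero_smul k _, Finset.sum_filter]
  refine Fintype.sum_equiv e _ _ fun ψ => ?_
  rw [smul_eq_mul, mul_ite, mul_one, mul_zero]
  rfl

lemma pairing_flip_bijective [Finite T] : Function.Bijective (pairing k T X).flip := by
  classical
  let _ := Fintype.ofFinite (X → T)
  let _ : LocallyFiniteOrder (X → T) := Fintype.toLocallyFiniteOrder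
  refine ⟨(injective_iff_map_eq_zero _).2 fun w hw => ?_, fun f => ?_⟩
  · let w : (X → Tᵒᵈ) →₀ k := w
    have apply_eq_zero : (fun ψ : X → T => w (OrderDual.toDual ∘ ψ)) = fun _ => 0 := by
      refine eq_of_sum_upper_eq fun φ => ?_
      rw [Finset.sum_const_zero, ← pairing_of_apply]
      exact LinearMap.congr_fun hw (FT.of k φ)
    exact Finsupp.ext (congrFun apply_eq_zero)
  · let w : (X → Tᵒᵈ) →₀ k := Finsupp.equivFunOnFinite.symm fun ψ =>
      ∑ χ : X → T with OrderDual.ofDual ∘ ψ ≤ χ,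
        IncidenceAlgebra.mu k (OrderDual.ofDual ∘ ψ) χ • f (FT.of k χ)
    refine ⟨w, FT.lhom_ext fun φ => (pairing_of_apply φ w).trans ?_⟩
    exact sum_upper_sum_mu_smul (fun χ => f (FT.of k χ)) φ

end Pairing

section Irreducibles

variable {k : Type v} [CommRing k] {T : Type u} [Lattice T] [BoundedOrder T] [Finite T]

lemma le_rJoin_iff_lt {e : T} (he : SupIrred e) {t : T} : t ≤ rJoin e ↔ t < e := by
  refine ⟨fun h => h.trans_lt ?_, fun h => ?_⟩
  · refine lt_of_le_of_ne (Finset.sup_le fun s hs => ?_) fun h => ?_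
    · exact ((Set.Finite.mem_toFinset _).1 hs).le
    · obtain ⟨s, hs, hse⟩ := he.finset_sup_eq h
      exact ((Set.Finite.mem_toFinset _).1 hs).ne hse
  · exact Finset.le_sup (f := id) ((Set.Finite.mem_toFinset _).2 h)

open Classical in
lemma pairing_of_gammaT (φ : irr T → T) :
    pairing k T (irr T) (FT.of k φ) (gammaT T k) = if φ = irrIncl T then 1 else 0 := by
  let _ := Fintype.ofFinite (irr T)
  have le_eta_iff (A : Finset (irr T)) : (∀ e, φ e ≤ eta T A e) ↔
      (∀ e ∈ Finset.univ \ A, φ e ≤ irrIncl T e) ∧ ∀ e ∈ A, φ e < irrIncl T e := by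
    simp only [eta, irrIncl, Finset.mem_sdiff, Finset.mem_univ, true_and, ← forall_and]
    refine forall_congr' fun e => ?_
    by_cases he : e ∈ A
    · simp [he, le_rJoin_iff_lt e.2]
    · simp [he]
  have factor_eq (e : irr T) :
      (if φ e ≤ irrIncl T e then 1 else 0) - (if φ e < irrIncl T e then 1 else 0) =
        if φ e = irrIncl T e then (1 : k) else 0 := by
    by_cases he : φ e = irrIncl T e
    · simp [he]
    · simp [he, le_iff_lt_or_eq]
  calc pairing k T (irr T) (FT.of k φ) (gammaT T k)
      = ∏ e : irr T,
          ((if φ e ≤ irrIncl T e then 1 else 0) - (if φ e < irrIncl T e then 1 else 0)) := by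
        rw [Finset.prod_sub, Finset.powerset_univ, gammaT, map_sum]
        refine Finset.sum_congr (by ext; simp) fun A _ => ?_
        rw [map_smul, pairing_of_of, Finset.prod_boole, Finset.prod_boole, smul_eq_mul,
          mul_assoc, ite_zero_mul_ite_zero, mul_one]
        congr! 2
        exact le_eta_iff A
    _ = _ := by
        rw [Finset.prod_congr rfl fun e _ => factor_eq e, Finset.prod_boole]
        by_cases hφ : φ = irrIncl T
        · rw [if_pos hφ, if_pos fun e _ => congrFun hφ e]
        · rw [if_neg hφ, if_neg fun h => hφ (funext fun e => h e (Finset.mem_univ e))]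

lemma exists_act_irrIncl {X : FinCorr.{u}} (φ : X → T) :
    ∃ Q : irr T ⟶ X, act Q (irrIncl T) = φ := by
  let Q : irr T ⟶ X := toHom {p | p.2.1 ≤ φ p.1}
  refine ⟨Q, funext fun x => le_antisymm ((act_le Q _ x _).2 fun e he => he) ?_⟩
  obtain ⟨s, hs, s_irred⟩ := exists_supIrred_decomposition (φ x)
  rw [← hs]
  refine Finset.sup_le fun e he => ?_
  exact (act_le Q (irrIncl T) x _).1 le_rfl ⟨e, s_irred he⟩
    (show e ≤ φ x from hs ▸ Finset.le_sup (f := id) he)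

lemma act_irrIncl_eq_iff (Q : End (irr T)) :
    act Q (irrIncl T) = irrIncl T ↔ IsReflSubrel (irrOrder T).op Q := by
  constructor
  · refine fun h => ⟨fun e => ?_, fun p hp => (act_le Q _ p.1 _).1 (congrFun h p.1).le p.2 hp⟩
    obtain ⟨x, hx, hxe⟩ := e.2.finset_sup_eq (congrFun h e)
    have hmem : (e, x) ∈ relOf Q := (Set.toFinite {x : irr T | (e, x) ∈ relOf Q}).mem_toFinset.1 hx
    obtain rfl : x = e := Subtype.ext hxe
    exact hmem
  · rintro ⟨hrefl, hle⟩
    refine funext fun e => le_antisymm ((act_le Q _ e _).2 fun x hx => hle hx) ?_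
    exact (act_le Q (irrIncl T) e _).1 le_rfl e (hrefl e)

lemma generates_irrIncl : Generates (FT.of k (irrIncl T)) := by
  intro X
  rw [← LinearMap.range_eq_top, eq_top_iff, ← FT.span_range_of, Submodule.span_le]
  rintro _ ⟨φ, rfl⟩
  obtain ⟨Q, rfl⟩ := exists_act_irrIncl φ
  exact ⟨Finsupp.single Q 1, by rw [genMap_single, FT.map_of]⟩

open Classical in
lemma pairing_map_irrIncl_map_gammaT {X : FinCorr.{u}} (P Q : irr T ⟶ X) :
    pairing k T X ((FT k T).map P (FT.of k (irrIncl T))) ((FT k Tᵒᵈ).map Q (gammaT T k)) =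
      if IsReflSubrel (irrOrder T).op (P ≫ opCorr Q) then 1 else 0 := by
  rw [pairing_map, FT.map_of, FT.map_of, ← act_comp, pairing_of_gammaT]
  exact if_congr (act_irrIncl_eq_iff (P ≫ opCorr Q)) rfl rfl

lemma pairing_genMap_irrIncl {X : FinCorr.{u}} (u : (irr T ⟶ X) →₀ k) (Q : irr T ⟶ X) :
    pairing k T X (genMap (FT.of k (irrIncl T)) X u) ((FT k Tᵒᵈ).map Q (gammaT T k)) =
      orderForm k (irrOrder T).op (opCorr Q) u := by
  let form := (pairing k T X).flip ((FT k Tᵒᵈ).map Q (gammaT T k))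
  refine (Finsupp.apply_linearCombination k form _ u).trans ?_
  exact congrArg (Finsupp.linearCombination k · u)
    (funext fun P => pairing_map_irrIncl_map_gammaT P Q)

lemma pairing_genMap_gammaT {X : FinCorr.{u}} (P : irr T ⟶ X) (u : (irr T ⟶ X) →₀ k) :
    pairing k T X ((FT k T).map P (FT.of k (irrIncl T))) (genMap (gammaT T k) X u) =
      orderForm k (irrOrder T) (opCorr P) u := by
  let form := pairing k T X ((FT k T).map P (FT.of k (irrIncl T)))
  refine (Finsupp.apply_linearCombination k form _ u).trans ?_
  refine congrArg (Finsupp.linearCombination k · u) (funext fun Q => ?_)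
  classical
  exact (pairing_map_irrIncl_map_gammaT P Q).trans
    (if_congr (isReflSubrel_op_comp_opCorr_iff (irrOrder T) P Q) rfl rfl)

lemma genMap_irrIncl_mem_perpLeft_iff {X : FinCorr.{u}} (u : (irr T ⟶ X) →₀ k) :
    genMap (FT.of k (irrIncl T)) X u ∈ (perpLeft (gammaSub T k)).obj X ↔
      genMap (fundGen k (irrOrder T).op) X u = 0 := by
  rw [genMap_fundGen_eq_zero_iff]
  constructor
  · intro h ψ
    exact (pairing_genMap_irrIncl u (opCorr ψ)).symm.trans
      (h _ (Submodule.subset_span ⟨opCorr ψ, rfl⟩))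
  · intro h
    have span_le : (gammaSub T k).obj X ≤
        LinearMap.ker (pairing k T X (genMap (FT.of k (irrIncl T)) X u)) := by
      refine Submodule.span_le.2 ?_
      rintro _ ⟨Q, rfl⟩
      exact (pairing_genMap_irrIncl u Q).trans (h (opCorr Q))
    exact fun w hw => span_le hw

lemma genMap_gammaT_eq_zero_iff {X : FinCorr.{u}} (u : (irr T ⟶ X) →₀ k) :
    genMap (gammaT T k) X u = 0 ↔ genMap (fundGen k (irrOrder T)) X u = 0 := by
  rw [genMap_fundGen_eq_zero_iff]
  constructor
  · intro h ψ
    refine (pairing_genMap_gammaT (opCorr ψ) u).symm.trans ?_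
    rw [h, map_zero]
  · intro h
    refine (injective_iff_map_eq_zero _).1 pairing_flip_bijective.1 _ (FT.lhom_ext fun φ => ?_)
    obtain ⟨P, rfl⟩ := exists_act_irrIncl φ
    rw [← FT.map_of]
    exact (pairing_genMap_gammaT P u).trans (h (opCorr P))

lemma genMap_gammaGen_eq_zero_iff {X : FinCorr.{u}} (u : (irr T ⟶ X) →₀ k) :
    genMap (F := (gammaSub T k).toFunctor) (gammaGen T k) X u = 0 ↔
      genMap (fundGen k (irrOrder T)) X u = 0 := by
  rw [← genMap_gammaT_eq_zero_iff]
  have := app_genMap (gammaSub T k).incl (gammaGen T k) X u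
  exact Subtype.ext_iff.trans (Eq.congr_left this)

end Irreducibles

/-! ### Quotients, orthogonals and the canonical morphism -/

section Duality

variable {k : Type v} [CommRing k]

lemma iso_app_injective {F F' : CorrFunctor.{u} k} (i : F ≅ F') (X : FinCorr.{u}) :
    Function.Injective (i.hom.app X) :=
  ((ConcreteCategory.isIso_iff_bijective (i.hom.app X)).1 inferInstance).1

lemma exists_quot_iso {F F' : CorrFunctor.{u} k} {G : Sub F} {θ : F ⟶ F'} (hG : G = Sub.ker θ)
    (hθ : ∀ X, Function.Surjective (θ.app X)) : ∃ i : G.quot ≅ F', G.proj ≫ i.hom = θ := by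
  subst hG
  let e (X : FinCorr.{u}) : (F.obj X ⧸ LinearMap.ker (θ.app X).hom) ≃ₗ[k] F'.obj X :=
    (θ.app X).hom.quotKerEquivOfSurjective (hθ X)
  refine ⟨NatIso.ofComponents (fun X => (e X).toModuleIso) fun {X Y} Q => ?_, rfl⟩
  ext x
  obtain ⟨y, rfl⟩ := Submodule.mkQ_surjective _ x
  exact NatTrans.naturality_apply θ Q y

/-- A surjection `f : M → S` embeds `Hom(S, k)` into `Hom(M, k)` as the forms vanishing on
`ker f`; a perfect pairing identifies these forms with the orthogonal of `ker f`. -/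
lemma exists_equiv_dual_of_perfect {M N S : Type*} [AddCommGroup M] [Module k M]
    [AddCommGroup N] [Module k N] [AddCommGroup S] [Module k S] {B : M →ₗ[k] N →ₗ[k] k}
    (hB : Function.Bijective B.flip) {f : M →ₗ[k] S} (hf : Function.Surjective f)
    {P : Submodule k N} (hP : ∀ w, w ∈ P ↔ ∀ a ∈ LinearMap.ker f, B a w = 0) :
    ∃ e : P ≃ₗ[k] Module.Dual k S, ∀ w a, e w (f a) = B a w := by
  let flipEquiv : N ≃ₗ[k] Module.Dual k M := LinearEquiv.ofBijective B.flip hB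
  let dualEquiv : Module.Dual k S ≃ₗ[k] LinearMap.range f.dualMap :=
    LinearEquiv.ofInjective f.dualMap (LinearMap.dualMap_injective_of_surjective hf)
  have map_eq : P.map flipEquiv.toLinearMap = LinearMap.range f.dualMap := by
    rw [LinearMap.range_dualMap_eq_dualAnnihilator_ker_of_surjective f hf]
    ext g
    obtain ⟨w, rfl⟩ := flipEquiv.surjective g
    rw [Submodule.mem_dualAnnihilator]
    exact (Submodule.mem_map_equiv P).trans (by rw [LinearEquiv.symm_apply_apply]; exact hP w)
  let e := (flipEquiv.submoduleMap P).trans ((LinearEquiv.ofEq _ _ map_eq).trans dualEquiv.symm)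
  refine ⟨e, fun w a => ?_⟩
  have dualMap_apply : f.dualMap (e w) = B.flip w :=
    congrArg Subtype.val (dualEquiv.apply_symm_apply _)
  exact LinearMap.congr_fun dualMap_apply a

lemma exists_perpRight_iso_dual {T : Type u} [Lattice T] [BoundedOrder T] [Finite T]
    {F : CorrFunctor.{u} k} {H : Sub (FT k T)} {θ : FT k T ⟶ F} (hH : H = Sub.ker θ)
    (hθ : ∀ X, Function.Surjective (θ.app X)) :
    ∃ j : (perpRight H).toFunctor ≅ dual F,
      ∀ (X : FinCorr.{u}) (w : (perpRight H).obj X) (a : (FT k T).obj X),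
        dualApply (j.hom.app X w) (θ.app X a) = pairing k T X a w.1 := by
  subst hH
  have exists_equiv (X : FinCorr.{u}) :
      ∃ e : (perpRight (Sub.ker θ)).obj X ≃ₗ[k] Module.Dual k (F.obj X),
        ∀ w a, e w (θ.app X a) = pairing k T X a w.1 :=
    exists_equiv_dual_of_perfect pairing_flip_bijective (hθ X) fun w => Iff.rfl
  choose e he using exists_equiv
  refine ⟨NatIso.ofComponents (fun X => (e X).toModuleIso) fun {X Y} Q => ?_, he⟩
  ext w
  refine LinearMap.ext fun s => ?_
  obtain ⟨a, rfl⟩ := hθ Y s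
  calc e Y ((perpRight (Sub.ker θ)).toFunctor.map Q w) (θ.app Y a)
      = pairing k T Y a ((FT k Tᵒᵈ).map Q w.1) := he Y _ a
    _ = pairing k T X ((FT k T).map (opCorr Q) a) w.1 := pairing_map T k Q a w.1
    _ = e X w (θ.app X ((FT k T).map (opCorr Q) a)) := (he X w _).symm
    _ = e X w (F.map (opCorr Q) (θ.app Y a)) := by rw [NatTrans.naturality_apply θ (opCorr Q) a]

end Duality

section Canonical

variable {k : Type v} [CommRing k] {T : Type u} [Lattice T] [BoundedOrder T] [Finite T]

lemma perpLeft_gammaSub_eq_ker {Θ : FT k T ⟶ fundFunctor k (irrOrder T).op}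
    (hΘ : Θ.app (irr T) (FT.of k (irrIncl T)) = fundGen k (irrOrder T).op) :
    perpLeft (gammaSub T k) = Sub.ker Θ := by
  ext X x
  obtain ⟨u, rfl⟩ := generates_irrIncl X x
  refine (genMap_irrIncl_mem_perpLeft_iff u).trans ?_
  change _ ↔ Θ.app X _ = 0
  rw [app_genMap, hΘ]

variable (k T) in
lemma exists_hom_fundFunctor : ∃ Θ : FT k T ⟶ fundFunctor k (irrOrder T).op,
    Θ.app (irr T) (FT.of k (irrIncl T)) = fundGen k (irrOrder T).op := by
  refine generates_irrIncl.exists_hom _ fun X u hu => ?_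
  rw [← genMap_irrIncl_mem_perpLeft_iff, hu]
  exact Submodule.zero_mem _

variable (k T) in
lemma exists_fundFunctor_iso_gammaSub :
    ∃ β : fundFunctor k (irrOrder T) ≅ (gammaSub T k).toFunctor,
      β.hom.app (irr T) (fundGen k (irrOrder T)) = gammaGen T k :=
  (generates_fundGen (irrOrder T)).exists_iso (generates_gen (gammaT T k)) fun _ u =>
    (genMap_gammaGen_eq_zero_iff u).symm

lemma isCanonical_of_apply_eq_pairing {Θ : FT k T ⟶ fundFunctor k (irrOrder T).op}
    (hΘ : Θ.app (irr T) (FT.of k (irrIncl T)) = fundGen k (irrOrder T).op)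
    {α : fundFunctor k (irrOrder T) ⟶ dual (fundFunctor k (irrOrder T).op)}
    (hα : ∀ a, dualApply (α.app (irr T) (fundGen k (irrOrder T))) (Θ.app (irr T) a) =
      pairing k T (irr T) a (gammaT T k)) :
    IsCanonical k (irrOrder T) α := by
  classical
  intro σ
  have apply_perm : fundEval k (irrOrder T).op
      (fundRep k (irrOrder T).op (permRel σ) (fGen k (irrOrder T).op)) =
        Θ.app (irr T) (FT.of k (act (permRel σ) (irrIncl T))) := by
    rw [fundEval_fundRep, ← FT.map_of, NatTrans.naturality_apply, hΘ]
  have act_eq_iff : act (permRel σ) (irrIncl T) = irrIncl T ↔ σ = 1 :=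
    (act_irrIncl_eq_iff (permRel σ)).trans (isReflSubrel_permRel_iff (irrOrder T).op σ)
  rw [apply_perm]
  refine (hα _).trans ((pairing_of_gammaT _).trans ?_)
  exact if_congr act_eq_iff rfl rfl

end Canonical

end CorrFun

end

theorem mainTheorem7 {k : Type v} [CommRing k] (T : Type u) [Lattice T] [BoundedOrder T]
    [Finite T] :
    ∃ Θ : FT k T ⟶ fundFunctor k (irrOrder T).op,
      (Θ.app (irr T) (FT.of k (irrIncl T)) = fundEval k (irrOrder T).op (fGen k (irrOrder T).op) ∧
        ∀ Θ' : FT k T ⟶ fundFunctor k (irrOrder T).op,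
          Θ'.app (irr T) (FT.of k (irrIncl T)) =
            fundEval k (irrOrder T).op (fGen k (irrOrder T).op) → Θ' = Θ) ∧
      perpLeft (gammaSub T k) = Sub.ker Θ ∧
      (∃ i : (perpLeft (gammaSub T k)).quot ≅ fundFunctor k (irrOrder T).op,
        (perpLeft (gammaSub T k)).proj ≫ i.hom = Θ) ∧
      ∃ j : (perpRight (perpLeft (gammaSub T k))).toFunctor ≅
          dual (fundFunctor k (irrOrder T).op),
        (∀ (X : FinCorr.{u}) (w : (perpRight (perpLeft (gammaSub T k))).obj X)
          (a : (FT k T).obj X), dualApply (j.hom.app X w) (Θ.app X a) = pairing k T X a w.1) ∧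
        ∃ (β : fundFunctor k (irrOrder T) ≅ (gammaSub T k).toFunctor)
          (α : fundFunctor k (irrOrder T) ⟶ dual (fundFunctor k (irrOrder T).op)),
          β.hom.app (irr T) (fundEval k (irrOrder T) (fGen k (irrOrder T))) = gammaGen T k ∧
          α = β.hom ≫ Sub.inclusion (le_perp_perp (gammaSub T k)) ≫ j.hom ∧
          (∀ X : FinCorr.{u}, Function.Injective (α.app X)) ∧
          IsCanonical k (irrOrder T) α ∧
          ∀ α' : fundFunctor k (irrOrder T) ⟶ dual (fundFunctor k (irrOrder T).op),
            IsCanonical k (irrOrder T) α' → α' = α := by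
  obtain ⟨Θ, hΘ⟩ := exists_hom_fundFunctor k T
  have Θ_surjective : ∀ X, Function.Surjective (Θ.app X) :=
    (generates_fundGen (irrOrder T).op).surjective_of_app_eq hΘ
  have perp_eq_ker : perpLeft (gammaSub T k) = Sub.ker Θ := perpLeft_gammaSub_eq_ker hΘ
  obtain ⟨j, hj⟩ := exists_perpRight_iso_dual perp_eq_ker Θ_surjective
  obtain ⟨β, hβ⟩ := exists_fundFunctor_iso_gammaSub k T
  let inclusion := Sub.inclusion (le_perp_perp (gammaSub T k))
  have canonical : IsCanonical k (irrOrder T) (β.hom ≫ inclusion ≫ j.hom) := by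
    refine isCanonical_of_apply_eq_pairing hΘ fun a => ?_
    have apply_gen : (β.hom ≫ inclusion ≫ j.hom).app (irr T) (fundGen k (irrOrder T)) =
        j.hom.app (irr T) (inclusion.app (irr T) (gammaGen T k)) :=
      congrArg (fun w => j.hom.app (irr T) (inclusion.app (irr T) w)) hβ
    rw [apply_gen]
    exact hj (irr T) _ a
  refine ⟨Θ, ⟨hΘ, fun Θ' hΘ' => generates_irrIncl.hom_ext (hΘ'.trans hΘ.symm)⟩, perp_eq_ker,
    exists_quot_iso perp_eq_ker Θ_surjective, j, hj, β, _, hβ, rfl, fun X => ?_, canonical,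
    fun α' hα' => hα'.eq canonical⟩
  exact (iso_app_injective j X).comp
    ((Submodule.inclusion_injective (le_perp_perp _ X)).comp (iso_app_injective β X))
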